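/- Let $\Delta=\{z\in\mathbb{C}:|z|<1\}$. Let $\tilde{\mathcal D}$ be the set of injective holomorphic functions $f:\Delta\to\mathbb{C}$ with $f(0)=0$ and $f'(0)=1$ that have a quasiconformal extension to $\mathbb{C}$, i.e. for which there is a quasiconformal homeomorphism $F:\mathbb{C}\to\mathbb{C}$ with $F|_\Delta=f$. (A homeomorphism $F$ of $\mathbb{C}$ onto itself is quasiconformal if $F\in W^{1,2}_{\mathrm{loc}}(\mathbb{C})$ and there is $k<1$ such that $|F_{\bar z}|\le k|F_z|$ almost everywhere.) Let $$\mathcal{A}_\infty(\Delta)=\Bigl\{\psi \text{ holomorphic on }\Delta:\ \|\psi\|_{\infty,1}=\sup_{z\in\Delta}|\psi(z)(1-|z|^2)|<\infty\Bigr\},$$ normed by $\|\cdot\|_{\infty,1}$, and for $f\in\tilde{\mathcal D}$ put $\theta(f)=f''/f'$. Then $\theta(f)\in\mathcal{A}_\infty(\Delta)$ for every $f\in\tilde{\mathcal D}$, and the image of the map $\theta:\tilde{\mathcal D}\to\mathcal{A}_\infty(\Delta)$ contains an open ball about the origin: there is $r>0$ such that every $\psi\in\mathcal{A}_\infty(\Delta)$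 with $\|\psi\|_{\infty,1}<r$ equals $\theta(f)$ for some $f\in\tilde{\mathcal D}$. -/

import Mathlib

open MeasureTheory Metric Complex
open scoped ContDiff

noncomputable section

namespace TeichCurve

/-- The open unit disc `Δ`. -/
abbrev Disc : Set ℂ := ball (0 : ℂ) 1

/-- The centre of the disc. -/
def Disc.zero : Disc := ⟨0, mem_ball_self one_pos⟩

/-- Extension by zero of a function on the disc. It only serves to speak about differentiation,
and is only ever differentiated at points of the open disc. -/
def extendZero (f : Disc → ℂ) : ℂ → ℂ := Function.extend Subtype.val f 0

theorem extendZero_apply (f : Disc → ℂ) (z : Disc) : extendZero f z = f z :=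
  Subtype.val_injective.extend_apply f 0 z

/-- `f` is holomorphic on the disc. -/
def IsHolomorphic (f : Disc → ℂ) : Prop := DifferentiableOn ℂ (extendZero f) Disc

/-- The complex derivative `f'` of a function on the disc. -/
def discDeriv (f : Disc → ℂ) : Disc → ℂ := fun z => deriv (extendZero f) z

/-- `θ(f) = f'' / f'`. -/
def theta (f : Disc → ℂ) : Disc → ℂ := fun z => discDeriv (discDeriv f) z / discDeriv f z

/-! ### Quasiconformal maps of the plane (analytic definition) -/

/-- `G` is the weak derivative of `F` on `ℂ = ℝ²` in the direction `v`. -/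
def HasWeakDirDeriv (F G : ℂ → ℂ) (v : ℂ) : Prop :=
  ∀ φ : ℂ → ℝ, ContDiff ℝ ∞ φ → HasCompactSupport φ →
    ∫ z, (fderiv ℝ φ z v) • F z = - ∫ z, φ z • G z

/-- `G` is locally square integrable on the plane. -/
def IsLocallyL2 (G : ℂ → ℂ) : Prop :=
  ∀ R : ℝ, MemLp G 2 (volume.restrict (closedBall (0 : ℂ) R))

/-- `F : ℂ → ℂ` is a quasiconformal map of the plane: a homeomorphism of `ℂ` onto itself, in the
Sobolev class `W^{1,2}_loc`, such that for some `k < 1` one has `|F_{z̄}| ≤ k |F_z|` almost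
everywhere, where `F_{z̄} = (F_x + i F_y) / 2` and `F_z = (F_x - i F_y) / 2`. -/
def IsQuasiconformal (F : ℂ → ℂ) : Prop :=
  IsHomeomorph F ∧
  ∃ Fx Fy : ℂ → ℂ,
    IsLocallyL2 Fx ∧ IsLocallyL2 Fy ∧
    HasWeakDirDeriv F Fx 1 ∧ HasWeakDirDeriv F Fy I ∧
    ∃ k : ℝ, 0 ≤ k ∧ k < 1 ∧
      ∀ᵐ z : ℂ, ‖(Fx z + I * Fy z) / 2‖ ≤ k * ‖(Fx z - I * Fy z) / 2‖

/-- The space `𝒟̃` of univalent functions `f` on the disc with `f(0) = 0`, `f'(0) = 1` that have a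
quasiconformal extension to `ℂ`. -/
def DTilde : Set (Disc → ℂ) :=
  {f | IsHolomorphic f ∧ Function.Injective f ∧ f Disc.zero = 0 ∧ discDeriv f Disc.zero = 1 ∧
    ∃ F : ℂ → ℂ, IsQuasiconformal F ∧ ∀ z : Disc, F z = f z}

/-! ### The Banach space `𝒜_∞(Δ)` -/

/-- The weighted values `|ψ(z) (1 - |z|²)|`, for `z` in the disc. -/
def weighted (ψ : Disc → ℂ) (z : Disc) : ℝ := ‖ψ z * (1 - (‖(z : ℂ)‖ : ℂ) ^ 2)‖

theorem weighted_add_le (ψ χ : Disc → ℂ) (z : Disc) :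
    weighted (ψ + χ) z ≤ weighted ψ z + weighted χ z := by
  simp only [weighted, Pi.add_apply, add_mul]
  exact norm_add_le _ _

theorem weighted_smul (c : ℂ) (ψ : Disc → ℂ) (z : Disc) :
    weighted (c • ψ) z = ‖c‖ * weighted ψ z := by
  simp [weighted, mul_assoc]

theorem weighted_nonneg (ψ : Disc → ℂ) (z : Disc) : 0 ≤ weighted ψ z := norm_nonneg _

theorem eq_zero_of_weighted {ψ : Disc → ℂ} {z : Disc} (h : weighted ψ z = 0) : ψ z = 0 := by
  have hz : ‖(z : ℂ)‖ < 1 := mem_ball_zero_iff.1 z.2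
  have h1 : (1 - (‖(z : ℂ)‖ : ℂ) ^ 2) ≠ 0 := by
    have : (1 - ‖(z : ℂ)‖ ^ 2 : ℝ) ≠ 0 := by nlinarith [norm_nonneg (z : ℂ)]
    exact_mod_cast this
  rcases mul_eq_zero.1 (norm_eq_zero.1 h) with h | h
  · exact h
  · exact absurd h h1

theorem extendZero_add (f g : Disc → ℂ) : extendZero (f + g) = extendZero f + extendZero g := by
  funext z
  by_cases hz : ∃ w : Disc, (w : ℂ) = z
  · obtain ⟨w, rfl⟩ := hz
    simp [extendZero_apply]
  · simp [extendZero, Function.extend_apply' _ _ _ hz]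

theorem extendZero_smul (c : ℂ) (f : Disc → ℂ) : extendZero (c • f) = c • extendZero f := by
  funext z
  by_cases hz : ∃ w : Disc, (w : ℂ) = z
  · obtain ⟨w, rfl⟩ := hz
    simp [extendZero_apply]
  · simp [extendZero, Function.extend_apply' _ _ _ hz]

/-- The holomorphic functions `ψ` on the disc with `sup_z |ψ(z) (1 - |z|²)| < ∞`, as a linear
subspace of all functions on the disc. -/
def blochSubmodule : Submodule ℂ (Disc → ℂ) where
  carrier := {ψ | IsHolomorphic ψ ∧ BddAbove (Set.range (weighted ψ))}
  add_mem' := by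
    rintro ψ χ ⟨h1, B, hB⟩ ⟨h2, C, hC⟩
    refine ⟨?_, B + C, ?_⟩
    · rw [IsHolomorphic, extendZero_add]
      exact h1.add h2
    · rintro _ ⟨z, rfl⟩
      exact (weighted_add_le ψ χ z).trans (add_le_add (hB ⟨z, rfl⟩) (hC ⟨z, rfl⟩))
  zero_mem' := by
    refine ⟨?_, 0, ?_⟩
    · have : extendZero (0 : Disc → ℂ) = 0 := by simpa using extendZero_smul 0 0
      rw [IsHolomorphic, this]
      exact differentiableOn_const 0
    · rintro _ ⟨z, rfl⟩
      simp [weighted]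
  smul_mem' := by
    rintro c ψ ⟨h1, B, hB⟩
    refine ⟨?_, ‖c‖ * B, ?_⟩
    · rw [IsHolomorphic, extendZero_smul]
      exact h1.const_smul c
    · rintro _ ⟨z, rfl⟩
      rw [weighted_smul]
      exact mul_le_mul_of_nonneg_left (hB ⟨z, rfl⟩) (norm_nonneg c)

/-- The space `𝒜_∞(Δ)`. (A type of its own, so that it carries only the topology of the norm
below and not the topology of pointwise convergence.) -/
def BlochSpace : Type := blochSubmodule

namespace BlochSpace

instance : AddCommGroup BlochSpace := inferInstanceAs (AddCommGroup blochSubmodule)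

instance : Module ℂ BlochSpace := inferInstanceAs (Module ℂ blochSubmodule)

/-- The underlying function on the disc. -/
def toFun (ψ : BlochSpace) : Disc → ℂ := Subtype.val ψ

/-- `‖ψ‖_{∞,1} = sup_z |ψ(z) (1 - |z|²)|`. -/
instance : Norm BlochSpace := ⟨fun ψ => ⨆ z : Disc, weighted ψ.toFun z⟩

theorem norm_def (ψ : BlochSpace) : ‖ψ‖ = ⨆ z : Disc, weighted ψ.toFun z := rfl

theorem weighted_le_norm (ψ : BlochSpace) (z : Disc) : weighted ψ.toFun z ≤ ‖ψ‖ :=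
  le_ciSup ψ.2.2 z

theorem normCore : NormedSpace.Core ℂ BlochSpace where
  norm_nonneg ψ := Real.iSup_nonneg fun z => weighted_nonneg _ z
  norm_smul c ψ := by
    rw [norm_def, norm_def, Real.mul_iSup_of_nonneg (norm_nonneg c)]
    exact iSup_congr fun z => weighted_smul c ψ.toFun z
  norm_triangle ψ χ := by
    have : Nonempty Disc := ⟨Disc.zero⟩
    refine ciSup_le fun z => ?_
    exact (weighted_add_le ψ.toFun χ.toFun z).trans
      (add_le_add (weighted_le_norm ψ z) (weighted_le_norm χ z))
  norm_eq_zero_iff ψ := by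
    constructor
    · intro h
      refine Subtype.ext (funext fun z => ?_)
      exact eq_zero_of_weighted
        (le_antisymm (h ▸ weighted_le_norm ψ z) (weighted_nonneg _ z))
    · rintro rfl
      have : ∀ z : Disc, weighted (0 : BlochSpace).toFun z = 0 := fun z => by
        have : (0 : BlochSpace).toFun z = 0 := rfl
        simp [weighted, this]
      simp [norm_def, this]

instance : NormedAddCommGroup BlochSpace := NormedAddCommGroup.ofCore normCore

instance : NormedSpace ℂ BlochSpace := NormedSpace.ofCore normCore

end BlochSpace

end TeichCurve

end

/-! That `θ(f)` has finite norm is a bound on the second coefficient: `|g''(0)| ≤ C |g'(0)|` for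
univalent `g` on the disc, applied to `f` rescaled from the disc of radius `1 - |z|` about `z`. The
sharp constant is irrelevant, so a nearest omitted value, a square root and Cauchy's estimates
suffice (`norm_deriv_deriv_zero_le_of_injOn`).

For the ball, solve `Ψ' = ψ`, `f' = exp Ψ` and extend `f` outside the closed disc by `F(z) = f(ζ) +
(z - ζ) f'(ζ)`, where `ζ = 1 / conj z`. There `F_z = f'(ζ)`, and the Beltrami coefficient `-(z - ζ)
ζ² ψ(ζ)` is small with `ψ`. It remains to see that `F` is a homeomorphism in `W^{1,2}_loc`.

Since `|ψ| ≤ ε / (1 - |z|)`, `f'` varies so slowly that `f` stays close to its linear part at `p`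
all the way to the circle (`norm_sub_linear_le`), and reflection carries this across
(`norm_reflectExtend_sub_linear_le`). So around every point and at every scale `F` is an affine
conformal map up to relative error `1/4` (`exists_linear_approx`). Continuity, injectivity and, by a
nearest-point argument, surjectivity follow; univalence of `f` is part of this conclusion.

Off the circle `F` is real differentiable, and its derivative grows at most like a small negative
power of the distance to the circle. Almost every line of a given direction can be integrated along,
with at most two exceptional points, so the classical derivative is the weak one. -/

open scoped ComplexConjugate Topology

/-! ### Univalent functions on the disc and the second-coefficient bound. -/

open Filter Topology Set in
/-- The inverse of an injective holomorphic function is holomorphic. -/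
theorem exists_holomorphic_inverse {U : Set ℂ} (hU : IsOpen U) {f : ℂ → ℂ}
    (hf : DifferentiableOn ℂ f U) (hinj : InjOn f U) :
    ∃ G : ℂ → ℂ, IsOpen (f '' U) ∧ (∀ z ∈ U, G (f z) = z) ∧ DifferentiableOn ℂ G (f '' U) := by
  have han : ∀ z ∈ U, AnalyticAt ℂ f z := fun z hz => hf.analyticAt (hU.mem_nhds hz)
  have hncon : ∀ z ∈ U, ¬ ∀ᶠ w in 𝓝 z, f w = f z := by
    intro z hz h
    have h1 : ∀ᶠ w in 𝓝 z, w = z := by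
      filter_upwards [h, hU.mem_nhds hz] with w hw hwU using hinj hwU hz hw
    have h2 : ∀ᶠ w in 𝓝[≠] z, w = z := h1.filter_mono nhdsWithin_le_nhds
    have h3 : ∀ᶠ w in 𝓝[≠] z, w ≠ z := eventually_mem_nhdsWithin
    obtain ⟨w, hw, hw'⟩ := (h2.and h3).exists
    exact hw' hw
  have hopen : ∀ z ∈ U, 𝓝 (f z) ≤ map f (𝓝 z) := fun z hz =>
    ((han z hz).eventually_constant_or_nhds_le_map_nhds).resolve_left (hncon z hz)
  have himage : ∀ z ∈ U, ∀ W ∈ 𝓝 z, f '' W ∈ 𝓝 (f z) := fun z hz W hW =>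
    hopen z hz (image_mem_map hW)
  set G := Function.invFunOn f U with hG
  have hGf : ∀ z ∈ U, G (f z) = z := fun z hz => hinj.leftInvOn_invFunOn hz
  have hfU : IsOpen (f '' U) := by
    rw [isOpen_iff_mem_nhds]
    rintro _ ⟨z, hz, rfl⟩
    exact himage z hz U (hU.mem_nhds hz)
  have hGc : ∀ z ∈ U, ContinuousAt G (f z) := by
    intro z hz
    rw [ContinuousAt, hGf z hz]
    intro W hW
    rw [mem_map]
    refine mem_of_superset (himage z hz (W ∩ U) (inter_mem hW (hU.mem_nhds hz))) ?_
    rintro _ ⟨w, ⟨hwW, hwU⟩, rfl⟩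
    simpa [hGf w hwU] using hwW
  have hGd : ∀ z ∈ U, deriv f z ≠ 0 → DifferentiableAt ℂ G (f z) := by
    intro z hz hne
    have hd : HasDerivAt f (deriv f z) (G (f z)) := by
      rw [hGf z hz]
      exact (han z hz).differentiableAt.hasDerivAt
    refine (hd.of_local_left_inverse (hGc z hz) hne ?_).differentiableAt
    filter_upwards [hfU.mem_nhds (mem_image_of_mem f hz)]
    rintro _ ⟨w, hw, rfl⟩
    rw [hGf w hw]
  refine ⟨G, hfU, hGf, ?_⟩
  rintro _ ⟨z, hz, rfl⟩
  refine DifferentiableAt.differentiableWithinAt ?_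
  -- Critical points are isolated, as `f` is nowhere locally constant; `G` is continuous at their
  -- images, so these are removable singularities.
  have hz' : ∀ᶠ w in 𝓝[≠] z, deriv f w ≠ 0 := by
    refine ((han z hz).deriv.eventually_eq_zero_or_eventually_ne_zero).resolve_left fun h => ?_
    obtain ⟨r, hr, hrU⟩ := Metric.mem_nhds_iff.1 (inter_mem h (hU.mem_nhds hz))
    refine hncon z hz ?_
    filter_upwards [ball_mem_nhds z hr] with w hw
    refine isOpen_ball.is_const_of_deriv_eq_zero (convex_ball z r).isPreconnected
      (hf.mono fun x hx => (hrU hx).2) (fun x hx => (hrU hx).1) hw (mem_ball_self hr)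
  rw [eventually_nhdsWithin_iff] at hz'
  have hN : f '' ({w | w ∈ ({z}ᶜ : Set ℂ) → deriv f w ≠ 0} ∩ U) ∈ 𝓝 (f z) :=
    himage z hz _ (inter_mem hz' (hU.mem_nhds hz))
  have := (differentiableOn_compl_singleton_and_continuousAt_iff (f := G) hN).1 ⟨?_, hGc z hz⟩
  · exact this.differentiableAt hN
  · rintro _ ⟨⟨w, ⟨hw, hwU⟩, rfl⟩, hne⟩
    refine (hGd w hwU (hw fun h => hne ?_)).differentiableWithinAt
    rw [mem_singleton_iff.1 h]
    rfl

open Set in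
theorem deriv_ne_zero_of_injOn {U : Set ℂ} (hU : IsOpen U) {f : ℂ → ℂ}
    (hf : DifferentiableOn ℂ f U) (hinj : InjOn f U) {z : ℂ} (hz : z ∈ U) : deriv f z ≠ 0 := by
  obtain ⟨G, hfU, hGf, hG⟩ := exists_holomorphic_inverse hU hf hinj
  have h1 := (hG.differentiableAt (hfU.mem_nhds (mem_image_of_mem f hz))).hasDerivAt.comp z
    (hf.differentiableAt (hU.mem_nhds hz)).hasDerivAt
  have h2 : HasDerivAt (G ∘ f) 1 z := by
    refine (hasDerivAt_id z).congr_of_eventuallyEq ?_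
    filter_upwards [hU.mem_nhds hz] with w hw using hGf w hw
  intro h
  have := h1.unique h2
  simp [h] at this

open Set in
/-- An injective holomorphic function on the unit disc cannot cover a disc about its value at the
centre of radius larger than the modulus of its derivative there. -/
theorem le_norm_deriv_of_ball_subset_image {g : ℂ → ℂ} (hg : DifferentiableOn ℂ g (ball 0 1))
    (hinj : InjOn g (ball 0 1)) {R : ℝ} (hR : 0 < R) (hsub : ball (g 0) R ⊆ g '' ball 0 1) :
    R ≤ ‖deriv g 0‖ := by
  obtain ⟨G, hfU, hGf, hG⟩ := exists_holomorphic_inverse isOpen_ball hg hinj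
  have h0 : (0 : ℂ) ∈ ball (0 : ℂ) 1 := mem_ball_self one_pos
  have h1 := (hG.differentiableAt (hfU.mem_nhds (mem_image_of_mem g h0))).hasDerivAt.comp 0
    (hg.differentiableAt (isOpen_ball.mem_nhds h0)).hasDerivAt
  have h2 : HasDerivAt (G ∘ g) 1 0 := by
    refine (hasDerivAt_id (0 : ℂ)).congr_of_eventuallyEq ?_
    filter_upwards [isOpen_ball.mem_nhds h0] with w hw using hGf w hw
  have h3 := h1.unique h2
  -- Schwarz lemma for the inverse, which maps the disc of radius `R` into the unit disc.
  have h4 : ‖deriv G (g 0)‖ ≤ 1 / R := by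
    refine norm_deriv_le_div_of_mapsTo_ball (hG.mono hsub) ?_ hR
    intro w hw
    obtain ⟨z, hz, rfl⟩ := hsub hw
    rw [hGf z hz, hGf 0 h0]
    exact ball_subset_closedBall hz
  have h5 : ‖deriv G (g 0)‖ * ‖deriv g 0‖ = 1 := by rw [← norm_mul, h3, norm_one]
  have : 1 ≤ 1 / R * ‖deriv g 0‖ := by
    exact h5.symm.trans_le (mul_le_mul_of_nonneg_right h4 (norm_nonneg _))
  rwa [div_mul_eq_mul_div, one_mul, le_div_iff₀ hR, one_mul] at this

open Set in
/-- A nonvanishing holomorphic function on a disc has a holomorphic square root. -/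
theorem exists_sq_eq_on_ball {g : ℂ → ℂ} (hg : DifferentiableOn ℂ g (ball 0 1))
    (hne : ∀ z ∈ ball (0 : ℂ) 1, g z ≠ 0) (h0 : g 0 = 1) :
    ∃ h : ℂ → ℂ, DifferentiableOn ℂ h (ball 0 1) ∧ h 0 = 1 ∧
      ∀ z ∈ ball (0 : ℂ) 1, h z ^ 2 = g z := by
  have hd : DifferentiableOn ℂ (fun z => deriv g z / g z) (ball 0 1) :=
    (hg.deriv isOpen_ball).div hg hne
  obtain ⟨L, hL0, hL⟩ := hd.isExactOn_ball.with_val_at 0 0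
  refine ⟨fun z => Complex.exp (L z / 2), ?_, by simp [hL0], ?_⟩
  · intro z hz
    exact (((hL z hz).differentiableAt.div_const 2).cexp).differentiableWithinAt
  · have hc : ∀ z ∈ ball (0 : ℂ) 1, HasDerivAt (fun z => Complex.exp (-L z) * g z) 0 z := by
      intro z hz
      have := ((hL z hz).neg.cexp).mul
        (hg.differentiableAt (isOpen_ball.mem_nhds hz)).hasDerivAt
      refine this.congr_deriv ?_
      have := hne z hz
      field_simp
      ring
    intro z hz
    have := isOpen_ball.is_const_of_deriv_eq_zero (convex_ball (0 : ℂ) 1).isPreconnected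
      (fun x hx => (hc x hx).differentiableAt.differentiableWithinAt)
      (fun x hx => (hc x hx).deriv) hz (mem_ball_self one_pos)
    simp only [hL0, h0, neg_zero, Complex.exp_zero, one_mul, Complex.exp_neg] at this
    rw [← Complex.exp_nat_mul]
    have he := Complex.exp_ne_zero (L z)
    have h2 : ((2 : ℕ) : ℂ) * (L z / 2) = L z := by push_cast; ring
    rw [h2]
    field_simp at this
    exact this.symm

open Set in
/-- Weak form of Bieberbach's inequality for the second coefficient. -/
theorem norm_deriv_deriv_zero_le_of_injOn {g : ℂ → ℂ} (hg : DifferentiableOn ℂ g (ball 0 1))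
    (hinj : InjOn g (ball 0 1)) : ‖deriv (deriv g) 0‖ ≤ 200 * ‖deriv g 0‖ := by
  obtain ⟨G, hfU, hGf, hG⟩ := exists_holomorphic_inverse isOpen_ball hg hinj
  have h0 : (0 : ℂ) ∈ ball (0 : ℂ) 1 := mem_ball_self one_pos
  have hgd : ∀ z ∈ ball (0 : ℂ) 1, HasDerivAt g (deriv g z) z := fun z hz =>
    (hg.differentiableAt (isOpen_ball.mem_nhds hz)).hasDerivAt
  have hne : ((g '' ball 0 1)ᶜ : Set ℂ).Nonempty := by
    rw [nonempty_compl]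
    intro h
    have := le_norm_deriv_of_ball_subset_image hg hinj (R := ‖deriv g 0‖ + 1) (by positivity)
      (by rw [h]; exact subset_univ _)
    linarith
  -- `b = g 0 + w` is an omitted value nearest to `g 0`. Omission permits a branch `h` of the square
  -- root of `1 - (g - g 0) / w`.
  obtain ⟨b, hb, hρ⟩ := hfU.isClosed_compl.exists_infDist_eq_dist hne (g 0)
  obtain ⟨w, rfl⟩ : ∃ w, b = g 0 + w := ⟨b - g 0, by ring⟩
  have hw : w ≠ 0 := by
    rintro rfl
    exact hb ⟨0, h0, by simp⟩
  have hsub : ball (g 0) ‖w‖ ⊆ g '' ball 0 1 := by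
    have := ball_infDist_compl_subset (s := g '' ball 0 1) (x := g 0)
    rwa [hρ, dist_self_add_right] at this
  have hwle : ‖w‖ ≤ ‖deriv g 0‖ :=
    le_norm_deriv_of_ball_subset_image hg hinj (norm_pos_iff.2 hw) hsub
  obtain ⟨h, hh, hh0, hsq⟩ := exists_sq_eq_on_ball (g := fun z => 1 - (g z - g 0) / w)
    ((differentiableOn_const 1).sub ((hg.sub_const _).div_const _))
    (fun z hz h => hb ⟨z, hz, by
      have : (g z - g 0) / w = 1 := by linear_combination -h
      rw [div_eq_one_iff_eq hw] at this
      rw [← this]; ring⟩) (by simp)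
  -- If `h z` were near `-1`, then `|h z ^ 2 - 1| ≤ (2/5)(12/5) < 1` would put `g z` in the disc of
  -- radius `‖w‖` about `g 0`. That disc is connected and covered by `g`, and `Re h²` is positive
  -- over it, so `Re h` cannot vanish there; yet it is `1` at the centre and negative at `g z`.
  have hcov : ∀ z ∈ ball (0 : ℂ) 1, (2 / 5 : ℝ) ≤ ‖h z + 1‖ := by
    intro z hz
    by_contra! hlt
    have hball : ∀ x ∈ ball (0 : ℂ) 1, ‖h x ^ 2 - 1‖ * ‖w‖ = ‖g x - g 0‖ := by
      intro x hx
      rw [hsq x hx, ← norm_mul, ← norm_neg]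
      congr 1
      field_simp
      ring
    have hgz : g z ∈ ball (g 0) ‖w‖ := by
      rw [mem_ball_iff_norm, ← hball z hz]
      have h1 : h z ^ 2 - 1 = (h z + 1) * ((h z + 1) - 2) := by ring
      have h2 : ‖h z + 1 - 2‖ ≤ ‖h z + 1‖ + 2 := by
        simpa using norm_sub_le (h z + 1) 2
      have h3 : ‖h z ^ 2 - 1‖ < 1 := by
        rw [h1, norm_mul]
        nlinarith [norm_nonneg (h z + 1)]
      nlinarith [norm_pos_iff.2 hw]
    have hc : ContinuousOn (fun ζ => (h (G ζ)).re) (ball (g 0) ‖w‖) := by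
      refine Complex.continuous_re.comp_continuousOn
        (hh.continuousOn.comp (hG.mono hsub).continuousOn ?_)
      intro ζ hζ
      obtain ⟨x, hx, rfl⟩ := hsub hζ
      rwa [hGf x hx]
    have hre : (h z).re < 0 := by
      have := (Complex.abs_re_le_norm (h z + 1)).trans_lt hlt
      rw [abs_lt] at this
      simp at this
      linarith
    obtain ⟨ζ, hζ, hζ0⟩ := (convex_ball (g 0) ‖w‖).isPreconnected.intermediate_value hgz
      (mem_ball_self (norm_pos_iff.2 hw)) hc (show (0 : ℝ) ∈ Icc _ _ by
        simp only [hGf z hz, hGf 0 h0, hh0, one_re, mem_Icc, zero_le_one, and_true]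
        exact hre.le)
    obtain ⟨x, hx, rfl⟩ := hsub hζ
    simp only [hGf x hx] at hζ0
    rw [mem_ball_iff_norm, ← hball x hx] at hζ
    have h1 : ‖h x ^ 2 - 1‖ < 1 := by
      by_contra! hcon
      nlinarith [norm_pos_iff.2 hw]
    have h2 := (Complex.abs_re_le_norm (h x ^ 2 - 1)).trans_lt h1
    rw [abs_lt] at h2
    simp [pow_two, hζ0] at h2
    nlinarith [h2.1]
  have hk0 : ∀ z ∈ ball (0 : ℂ) 1, h z + 1 ≠ 0 := by
    intro z hz h
    have := hcov z hz
    rw [h, norm_zero] at this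
    norm_num at this
  set k : ℂ → ℂ := fun z => (h z + 1)⁻¹ with hk
  have hkd : DifferentiableOn ℂ k (ball 0 1) := (hh.add_const 1).inv hk0
  have hkb : ∀ z ∈ ball (0 : ℂ) 1, ‖k z‖ ≤ 5 / 2 := by
    intro z hz
    rw [hk, norm_inv, inv_le_comm₀ (by linarith [hcov z hz]) (by norm_num)]
    linarith [hcov z hz]
  have hcl : DiffContOnCl ℂ k (ball 0 (1 / 2)) := by
    refine (hkd.mono ?_).diffContOnCl
    rw [closure_ball _ (by norm_num)]
    exact closedBall_subset_ball (by norm_num)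
  have hsphere : ∀ z ∈ sphere (0 : ℂ) (1 / 2), ‖k z‖ ≤ 5 / 2 := fun z hz =>
    hkb z (by simp at hz; simp [hz]; norm_num)
  have hk1 : ‖deriv k 0‖ ≤ 5 := by
    have := norm_deriv_le_of_forall_mem_sphere_norm_le (by norm_num) hcl hsphere
    linarith
  have hk2 : ‖deriv (deriv k) 0‖ ≤ 20 := by
    have := norm_iteratedDeriv_le_of_forall_mem_sphere_norm_le 2 (by norm_num) hcl hsphere
    rw [iteratedDeriv_succ, iteratedDeriv_one] at this
    norm_num [Nat.factorial] at this
    exact this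
  have hkd' : ∀ z ∈ ball (0 : ℂ) 1, HasDerivAt k (deriv k z) z := fun z hz =>
    (hkd.differentiableAt (isOpen_ball.mem_nhds hz)).hasDerivAt
  have hkd2 : HasDerivAt (deriv k) (deriv (deriv k) 0) 0 :=
    ((hkd.deriv isOpen_ball).differentiableAt (isOpen_ball.mem_nhds h0)).hasDerivAt
  have hgd2 : HasDerivAt (deriv g) (deriv (deriv g) 0) 0 :=
    ((hg.deriv isOpen_ball).differentiableAt (isOpen_ball.mem_nhds h0)).hasDerivAt
  -- This is `(g - g 0) / w = 1 - h²` with `h = 1/k - 1`. Differentiated twice at `0`, it bounds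
  -- `g''(0)` by the Cauchy estimates for the bounded function `k`: `8 (20 + 5) = 200`.
  have hrel : ∀ z ∈ ball (0 : ℂ) 1, (g z - g 0) * k z ^ 2 = w * (2 * k z - 1) := by
    intro z hz
    have h1 := hsq z hz
    have h2 := hk0 z hz
    simp only [hk]
    field_simp
    field_simp at h1
    linear_combination h1
  have hrel1 : ∀ z ∈ ball (0 : ℂ) 1,
      deriv g z * k z ^ 2 + (g z - g 0) * (2 * k z * deriv k z) = 2 * w * deriv k z := by
    intro z hz
    have h1 := ((hgd z hz).sub_const (g 0)).mul ((hkd' z hz).pow 2)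
    have h2 := (((hkd' z hz).const_mul 2).sub_const 1).const_mul w
    have h3 := (h1.congr_of_eventuallyEq (f₁ := fun z => w * (2 * k z - 1)) ?_).unique h2
    · simp at h3
      linear_combination h3
    · filter_upwards [isOpen_ball.mem_nhds hz] with x hx using (hrel x hx).symm
  have hrel2 : deriv (deriv g) 0 = 8 * (w * deriv (deriv k) 0 - deriv g 0 * deriv k 0) := by
    have h1 := (hgd2.mul ((hkd' 0 h0).pow 2)).add
      (((hgd 0 h0).sub_const (g 0)).mul (((hkd' 0 h0).const_mul 2).mul hkd2))
    have h2 := hkd2.const_mul (2 * w)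
    have h3 := (h1.congr_of_eventuallyEq (f₁ := fun z => 2 * w * deriv k z) ?_).unique h2
    · have hk00 : k 0 = 1 / 2 := by simp only [hk, hh0]; norm_num
      simp [hk00] at h3
      linear_combination 4 * h3
    · filter_upwards [isOpen_ball.mem_nhds h0] with x hx using (hrel1 x hx).symm
  rw [hrel2, norm_mul]
  have h1 := norm_sub_le (w * deriv (deriv k) 0) (deriv g 0 * deriv k 0)
  rw [norm_mul, norm_mul] at h1
  have h2 : ‖w‖ * ‖deriv (deriv k) 0‖ ≤ ‖deriv g 0‖ * 20 := by gcongr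
  have h3 : ‖deriv g 0‖ * ‖deriv k 0‖ ≤ ‖deriv g 0‖ * 5 := by gcongr
  norm_num
  linarith

-- The bound at the centre, applied to `ζ ↦ f (z + (1 - ‖z‖) ζ)`.
open Set in
theorem norm_deriv_deriv_mul_le_of_injOn {f : ℂ → ℂ} (hf : DifferentiableOn ℂ f (ball 0 1))
    (hinj : InjOn f (ball 0 1)) {z : ℂ} (hz : z ∈ ball (0 : ℂ) 1) :
    ‖deriv (deriv f) z‖ * (1 - ‖z‖) ≤ 200 * ‖deriv f z‖ := by
  have hz1 : 0 < 1 - ‖z‖ := by simpa using hz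
  set r : ℂ := ((1 - ‖z‖ : ℝ) : ℂ) with hr
  have hrn : ‖r‖ = 1 - ‖z‖ := by rw [hr, Complex.norm_real, Real.norm_of_nonneg hz1.le]
  have hr0 : r ≠ 0 := by rw [← norm_pos_iff, hrn]; exact hz1
  have hmaps : MapsTo (fun ζ => z + r * ζ) (ball (0 : ℂ) 1) (ball 0 1) := by
    intro ζ hζ
    rw [mem_ball_zero_iff] at hζ ⊢
    have := norm_add_le z (r * ζ)
    rw [norm_mul, hrn] at this
    nlinarith
  have hdf : ∀ x ∈ ball (0 : ℂ) 1, HasDerivAt f (deriv f x) x := fun x hx =>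
    (hf.differentiableAt (isOpen_ball.mem_nhds hx)).hasDerivAt
  have hdf2 : ∀ x ∈ ball (0 : ℂ) 1, HasDerivAt (deriv f) (deriv (deriv f) x) x := fun x hx =>
    ((hf.deriv isOpen_ball).differentiableAt (isOpen_ball.mem_nhds hx)).hasDerivAt
  have haff : ∀ ζ, HasDerivAt (fun ζ => z + r * ζ) r ζ := fun ζ => by
    simpa using ((hasDerivAt_id ζ).const_mul r).const_add z
  have hg1 : ∀ ζ ∈ ball (0 : ℂ) 1,
      HasDerivAt (fun ζ => f (z + r * ζ)) (deriv f (z + r * ζ) * r) ζ := fun ζ hζ =>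
    (hdf _ (hmaps hζ)).comp ζ (haff ζ)
  have h0 : (0 : ℂ) ∈ ball (0 : ℂ) 1 := mem_ball_self one_pos
  have hg2 : HasDerivAt (deriv fun ζ => f (z + r * ζ)) (deriv (deriv f) (z + r * 0) * r * r) 0 := by
    refine (((hdf2 _ (hmaps h0)).comp 0 (haff 0)).mul_const r).congr_of_eventuallyEq ?_
    filter_upwards [isOpen_ball.mem_nhds h0] with x hx using (hg1 x hx).deriv
  have := norm_deriv_deriv_zero_le_of_injOn (g := fun ζ => f (z + r * ζ))
    (fun ζ hζ => (hg1 ζ hζ).differentiableAt.differentiableWithinAt)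
    (fun x hx y hy hxy => by
      have := hinj (hmaps hx) (hmaps hy) hxy
      simpa [hr0] using this)
  rw [hg2.deriv, (hg1 0 h0).deriv] at this
  simp only [mul_zero, add_zero, norm_mul, hrn] at this
  nlinarith

/-! ### Distortion of solutions of `f'' / f' = ψ` for small `ψ`. -/

/-- `Ψ` and `f` are the solutions on the unit disc of `Ψ' = ψ`, `f' = exp Ψ` that vanish at the
origin, and `ψ` is bounded by `ε / (1 - ‖z‖)`; so `f'' / f' = ψ`. -/
structure IsPreSchwarzianSolution (ε : ℝ) (ψ Ψ f : ℂ → ℂ) : Prop where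
  nonneg : 0 ≤ ε
  hasDerivAt_log : ∀ z ∈ ball (0 : ℂ) 1, HasDerivAt Ψ (ψ z) z
  hasDerivAt : ∀ z ∈ ball (0 : ℂ) 1, HasDerivAt f (exp (Ψ z)) z
  bound : ∀ z ∈ ball (0 : ℂ) 1, ‖ψ z‖ * (1 - ‖z‖) ≤ ε
  log_zero : Ψ 0 = 0
  map_zero : f 0 = 0

namespace IsPreSchwarzianSolution

variable {ε : ℝ} {ψ Ψ f : ℂ → ℂ}

/-- Points of a segment from an interior point of the disc sit deep in the disc. -/
theorem depth_segment {p z : ℂ} {s u : ℝ} (hs : s ≤ 1 - ‖p‖) (hz : ‖z‖ ≤ 1)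
    (hu : u ∈ Set.Icc (0 : ℝ) 1) : (1 - u) * s ≤ 1 - ‖p + u * (z - p)‖ := by
  have h1 : p + u * (z - p) = ((1 - u : ℝ) : ℂ) * p + (u : ℂ) * z := by push_cast; ring
  have h2 := norm_add_le (((1 - u : ℝ) : ℂ) * p) ((u : ℂ) * z)
  rw [← h1, norm_mul, norm_mul, norm_real, norm_real, Real.norm_of_nonneg (by linarith [hu.2]),
    Real.norm_of_nonneg hu.1] at h2
  have h3 := mul_le_mul_of_nonneg_left hs (show 0 ≤ 1 - u by linarith [hu.2])
  have h4 := mul_le_mul_of_nonneg_left hz hu.1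
  linarith

theorem segment_mem_ball {p z : ℂ} {s u : ℝ} (hs0 : 0 < s) (hs : s ≤ 1 - ‖p‖) (hz : ‖z‖ ≤ 1)
    (hu : u ∈ Set.Ico (0 : ℝ) 1) : p + u * (z - p) ∈ ball (0 : ℂ) 1 := by
  have := depth_segment hs hz ⟨hu.1, hu.2.le⟩
  rw [mem_ball_zero_iff]
  nlinarith [hu.2]

theorem hasDerivAt_segment (p z : ℂ) (u : ℝ) :
    HasDerivAt (fun u : ℝ => p + u * (z - p)) (z - p) u := by
  simpa using ((ofRealCLM.hasDerivAt (x := u)).mul_const (z - p)).const_add p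

/-- The point at parameter `x` of the segment has depth at least `(1 - x) s`, so the derivative of
`Ψ` along it is at most `K s · ε / ((1 - x) s)`; integrate. The endpoint `z` may lie on the circle.
-/
theorem norm_log_sub_le (h : IsPreSchwarzianSolution ε ψ Ψ f) {p z : ℂ} {s K : ℝ} (hs0 : 0 < s)
    (hs : s ≤ 1 - ‖p‖) (hz : ‖z‖ ≤ 1) (hK : ‖z - p‖ ≤ K * s) {u : ℝ} (hu : u ∈ Set.Ico (0 : ℝ) 1) :
    ‖Ψ (p + u * (z - p)) - Ψ p‖ ≤ -(K * ε) * Real.log (1 - u) := by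
  have hmem : ∀ x ∈ Set.Icc (0 : ℝ) u, x ∈ Set.Ico (0 : ℝ) 1 := fun x hx =>
    ⟨hx.1, hx.2.trans_lt hu.2⟩
  have hd : ∀ x ∈ Set.Icc (0 : ℝ) u,
      HasDerivAt (fun u : ℝ => Ψ (p + u * (z - p)) - Ψ p) (ψ (p + x * (z - p)) * (z - p)) x :=
    fun x hx => ((h.hasDerivAt_log _ (segment_mem_ball hs0 hs hz (hmem x hx))).comp x
      (hasDerivAt_segment p z x)).sub_const _
  have hB : ∀ x ∈ Set.Icc (0 : ℝ) u,
      HasDerivAt (fun u : ℝ => -(K * ε) * Real.log (1 - u)) (K * ε / (1 - x)) x := by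
    intro x hx
    have hx1 : 1 - x ≠ 0 := by linarith [(hmem x hx).2]
    refine ((((hasDerivAt_id x).const_sub 1).log hx1).const_mul (-(K * ε))).congr_deriv ?_
    simp only [id]
    ring
  have := image_norm_le_of_norm_deriv_right_le_deriv_boundary' (a := 0) (b := u)
    (f := fun u : ℝ => Ψ (p + u * (z - p)) - Ψ p)
    (f' := fun x => ψ (p + x * (z - p)) * (z - p)) (B := fun u : ℝ => -(K * ε) * Real.log (1 - u))
    (B' := fun x => K * ε / (1 - x))
    (fun x hx => (hd x hx).continuousAt.continuousWithinAt)
    (fun x hx => (hd x ⟨hx.1, hx.2.le⟩).hasDerivWithinAt) (by simp)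
    (fun x hx => (hB x hx).continuousAt.continuousWithinAt)
    (fun x hx => (hB x ⟨hx.1, hx.2.le⟩).hasDerivWithinAt) ?_ (Set.right_mem_Icc.2 hu.1)
  · exact this
  · intro x hx
    have hx' := hmem x ⟨hx.1, hx.2.le⟩
    have h1 := h.bound _ (segment_mem_ball hs0 hs hz hx')
    have h2 := depth_segment hs hz ⟨hx'.1, hx'.2.le⟩
    have h3 : 0 < 1 - x := by linarith [hx'.2]
    rw [norm_mul, le_div_iff₀ h3]
    set y := ‖ψ (p + x * (z - p))‖
    have h4 : y * ((1 - x) * s) ≤ ε := (mul_le_mul_of_nonneg_left h2 (norm_nonneg _)).trans h1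
    have hK0 : 0 ≤ K := by
      have := (norm_nonneg (z - p)).trans hK
      exact nonneg_of_mul_nonneg_left this hs0
    calc y * ‖z - p‖ * (1 - x) ≤ y * (K * s) * (1 - x) := by gcongr
      _ = K * (y * ((1 - x) * s)) := by ring
      _ ≤ K * ε := by gcongr

theorem norm_exp_sub_one_le_exp_norm_sub_one (w : ℂ) : ‖exp w - 1‖ ≤ Real.exp ‖w‖ - 1 := by
  simpa using norm_exp_sub_sum_le_exp_norm_sub_sum w 1

theorem norm_deriv_sub_le (h : IsPreSchwarzianSolution ε ψ Ψ f) {p z : ℂ} {s K : ℝ} (hs0 : 0 < s)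
    (hs : s ≤ 1 - ‖p‖) (hz : ‖z‖ ≤ 1) (hK : ‖z - p‖ ≤ K * s) {u : ℝ} (hu : u ∈ Set.Ico (0 : ℝ) 1) :
    ‖exp (Ψ (p + u * (z - p))) - exp (Ψ p)‖ ≤ ‖exp (Ψ p)‖ * ((1 - u) ^ (-(K * ε)) - 1) := by
  have h1 : exp (Ψ (p + u * (z - p))) - exp (Ψ p)
      = exp (Ψ p) * (exp (Ψ (p + u * (z - p)) - Ψ p) - 1) := by
    rw [exp_sub]
    field_simp [exp_ne_zero]
  rw [h1, norm_mul]
  gcongr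
  refine (norm_exp_sub_one_le_exp_norm_sub_one _).trans ?_
  rw [Real.rpow_def_of_pos (by linarith [hu.2])]
  gcongr
  exact (h.norm_log_sub_le hs0 hs hz hK hu).trans_eq (mul_comm _ _)

/-- `f` is well approximated by its linear part at `p`, at scales up to the distance of `p` from
the circle and slightly beyond. -/
theorem norm_sub_linear_le (h : IsPreSchwarzianSolution ε ψ Ψ f) {p z : ℂ} {s K : ℝ} (hs0 : 0 < s)
    (hs : s ≤ 1 - ‖p‖) (hz : ‖z‖ < 1) (hK : ‖z - p‖ ≤ K * s) (ha : K * ε ≤ 1 / 2) :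
    ‖f z - f p - (z - p) * exp (Ψ p)‖ ≤ 2 * K ^ 2 * ε * s * ‖exp (Ψ p)‖ := by
  have hK0 : 0 ≤ K := nonneg_of_mul_nonneg_left ((norm_nonneg (z - p)).trans hK) hs0
  set a := K * ε with haeq
  have ha0 : 0 ≤ a := mul_nonneg hK0 h.nonneg
  have hball : ∀ x ∈ Set.Icc (0 : ℝ) 1, p + x * (z - p) ∈ ball (0 : ℂ) 1 := by
    intro x hx
    rcases hx.2.eq_or_lt with rfl | hlt
    · simpa using hz
    · exact segment_mem_ball hs0 hs hz.le ⟨hx.1, hlt⟩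
  have hd : ∀ x ∈ Set.Icc (0 : ℝ) 1,
      HasDerivAt (fun u : ℝ => f (p + u * (z - p)) - f p - u * (z - p) * exp (Ψ p))
        ((z - p) * (exp (Ψ (p + x * (z - p))) - exp (Ψ p))) x := by
    intro x hx
    refine ((((h.hasDerivAt _ (hball x hx)).comp x (hasDerivAt_segment p z x)).sub_const _).sub
      (((ofRealCLM.hasDerivAt (x := x)).mul_const (z - p)).mul_const (exp (Ψ p)))).congr_deriv ?_
    simp
    ring
  -- The majorant integrates `(1 - u) ^ (-a) - 1`. As `a < 1` it is continuous up to `u = 1`, so the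
  -- bound does not degenerate when `z` approaches the circle.
  have hB : ∀ x ∈ Set.Ico (0 : ℝ) 1,
      HasDerivAt (fun u : ℝ => K * s * ‖exp (Ψ p)‖ * ((1 - (1 - u) ^ (1 - a)) / (1 - a) - u))
        (K * s * ‖exp (Ψ p)‖ * ((1 - x) ^ (-a) - 1)) x := by
    intro x hx
    have hx1 : 1 - x ≠ 0 := by linarith [hx.2]
    have ha1 : 1 - a ≠ 0 := by linarith
    refine (((((((hasDerivAt_id x).const_sub 1).rpow_const (p := 1 - a) (Or.inl hx1)).const_sub
      1).div_const (1 - a)).sub (hasDerivAt_id x)).const_mul (K * s * ‖exp (Ψ p)‖)).congr_deriv ?_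
    have : (1 - a - 1) = -a := by ring
    simp only [id, this]
    field_simp
  have hBc : ContinuousOn
      (fun u : ℝ => K * s * ‖exp (Ψ p)‖ * ((1 - (1 - u) ^ (1 - a)) / (1 - a) - u))
      (Set.Icc 0 1) := by
    have : Continuous fun u : ℝ => (1 - u) ^ (1 - a) :=
      (Real.continuous_rpow_const (by linarith)).comp (continuous_const.sub continuous_id)
    fun_prop
  have := image_norm_le_of_norm_deriv_right_le_deriv_boundary' (a := 0) (b := 1)
    (fun x hx => (hd x hx).continuousAt.continuousWithinAt)
    (fun x hx => (hd x ⟨hx.1, hx.2.le⟩).hasDerivWithinAt) (by simp) hBc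
    (fun x hx => (hB x hx).hasDerivWithinAt) ?_ (Set.right_mem_Icc.2 zero_le_one)
  · have h0 : (0 : ℝ) ^ (1 - a) = 0 := Real.zero_rpow (by linarith)
    simp only [ofReal_one, one_mul, sub_self, h0, sub_zero, add_sub_cancel] at this
    refine this.trans ?_
    have h1 : 1 / (1 - a) - 1 ≤ 2 * a := by
      rw [sub_le_iff_le_add, div_le_iff₀ (by linarith)]
      nlinarith
    calc K * s * ‖exp (Ψ p)‖ * (1 / (1 - a) - 1) ≤ K * s * ‖exp (Ψ p)‖ * (2 * a) := by gcongr
      _ = 2 * K ^ 2 * ε * s * ‖exp (Ψ p)‖ := by rw [haeq]; ring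
  · intro x hx
    rw [norm_mul, mul_assoc]
    gcongr
    exact h.norm_deriv_sub_le hs0 hs hz.le hK hx

/-- Integration along the whole radius through `z`, from `0` to its endpoint on the circle, stopped
at parameter `‖z‖`. -/
theorem norm_deriv_le_rpow (h : IsPreSchwarzianSolution ε ψ Ψ f) {z : ℂ} (hz : ‖z‖ < 1) :
    ‖exp (Ψ z)‖ ≤ (1 - ‖z‖) ^ (-ε) := by
  rcases eq_or_ne z 0 with rfl | hz0
  · simp [h.log_zero]
  have hn : ‖z‖ ≠ 0 := norm_ne_zero_iff.2 hz0
  have hn' : (‖z‖ : ℂ) ≠ 0 := ofReal_ne_zero.2 hn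
  have := h.norm_deriv_sub_le (p := 0) (z := z / ‖z‖) (s := 1) (K := 1) one_pos (by simp)
    (by simp [hn]) (by simp [hn]) (u := ‖z‖) ⟨norm_nonneg _, hz⟩
  have hzz : (‖z‖ : ℂ) * (z / ‖z‖) = z := by field_simp
  simp only [zero_add, sub_zero, hzz, h.log_zero, exp_zero, norm_one, one_mul] at this
  have h2 := norm_le_norm_add_norm_sub' (exp (Ψ z)) 1
  rw [norm_one] at h2
  linarith

/-- The deviation of `f'` from its value at `p`, near the circle. -/
theorem depth_mul_norm_deriv_sub_le (h : IsPreSchwarzianSolution ε ψ Ψ f) {p ζ : ℂ} {K : ℝ}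
    (hp : ‖p‖ < 1) (hζ : ‖ζ‖ < 1) (hK : ‖ζ - p‖ ≤ K * (1 - ‖p‖)) (ha : (2 * K + 1) * ε ≤ 1 / 2) :
    (1 - ‖ζ‖) * ‖exp (Ψ ζ) - exp (Ψ p)‖
      ≤ 4 * (2 * K + 1) ^ 2 * ε * (1 - ‖p‖) * ‖exp (Ψ p)‖ := by
  set q := 1 - ‖ζ‖ with hq
  have hq0 : 0 < q := by linarith
  have hs0 : 0 < 1 - ‖p‖ := by linarith
  have hsub : ∀ z ∈ closedBall ζ (q / 2), ‖z‖ < 1 := by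
    intro z hz
    rw [mem_closedBall_iff_norm] at hz
    have := norm_le_norm_add_norm_sub' z ζ
    linarith
  have hd : ∀ z ∈ ball (0 : ℂ) 1, HasDerivAt (fun z => f z - f p - (z - p) * exp (Ψ p))
      (exp (Ψ z) - exp (Ψ p)) z := by
    intro z hz
    refine (((h.hasDerivAt z hz).sub_const _).sub
      (((hasDerivAt_id z).sub_const p).mul_const (exp (Ψ p)))).congr_deriv ?_
    simp
  have hcl : DiffContOnCl ℂ (fun z => f z - f p - (z - p) * exp (Ψ p)) (ball ζ (q / 2)) := by
    refine DifferentiableOn.diffContOnCl fun z hz => ?_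
    rw [closure_ball _ (by linarith)] at hz
    exact (hd z (by simpa using hsub z hz)).differentiableAt.differentiableWithinAt
  -- Cauchy's estimate for the error of the linear approximation. As `q ≤ (K + 1)(1 - ‖p‖)`, the
  -- circle of radius `q / 2` about `ζ` lies within `(2 K + 1)(1 - ‖p‖)` of `p`.
  have := norm_deriv_le_of_forall_mem_sphere_norm_le (half_pos hq0) hcl (C :=
    2 * (2 * K + 1) ^ 2 * ε * (1 - ‖p‖) * ‖exp (Ψ p)‖) ?_
  · rw [(hd ζ (by simpa using hζ)).deriv, le_div_iff₀ (half_pos hq0)] at this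
    linarith
  · intro z hz
    refine h.norm_sub_linear_le hs0 le_rfl (hsub z (sphere_subset_closedBall hz)) ?_ ha
    rw [mem_sphere_iff_norm] at hz
    have h1 := norm_sub_le_norm_sub_add_norm_sub z ζ p
    have h2 := norm_le_norm_add_norm_sub' p ζ
    rw [norm_sub_rev p ζ] at h2
    nlinarith

/-- `f'` is Lipschitz on hyperbolic discs. -/
theorem norm_deriv_sub_le_of_norm_sub_le (h : IsPreSchwarzianSolution ε ψ Ψ f) {p ζ : ℂ}
    (hp : ‖p‖ < 1) (hζ : ‖ζ - p‖ ≤ (1 - ‖p‖) / 2) (hε : ε ≤ 1) :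
    (1 - ‖p‖) * ‖exp (Ψ ζ) - exp (Ψ p)‖ ≤ 4 * ε * ‖ζ - p‖ * ‖exp (Ψ p)‖ := by
  have hs0 : 0 < 1 - ‖p‖ := by linarith
  have hdepth : ∀ z ∈ closedBall p ((1 - ‖p‖) / 2), (1 - ‖p‖) / 2 ≤ 1 - ‖z‖ := by
    intro z hz
    rw [mem_closedBall_iff_norm] at hz
    have := norm_le_norm_add_norm_sub' z p
    linarith
  have h1 : ‖Ψ ζ - Ψ p‖ ≤ 2 * ε / (1 - ‖p‖) * ‖ζ - p‖ := by
    refine (convex_closedBall p ((1 - ‖p‖) / 2)).norm_image_sub_le_of_norm_hasDerivWithin_le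
      (f := Ψ) (f' := ψ) (fun z hz => (h.hasDerivAt_log z ?_).hasDerivWithinAt) (fun z hz => ?_)
      (mem_closedBall_self (by linarith)) (mem_closedBall_iff_norm.2 hζ)
    · rw [mem_ball_zero_iff]
      linarith [hdepth z hz]
    · have h2 := hdepth z hz
      have h3 := h.bound z (by rw [mem_ball_zero_iff]; linarith)
      rw [le_div_iff₀ hs0]
      nlinarith [norm_nonneg (ψ z)]
  have h2 : ‖Ψ ζ - Ψ p‖ ≤ 1 := by
    refine h1.trans ?_
    calc 2 * ε / (1 - ‖p‖) * ‖ζ - p‖ ≤ 2 * ε / (1 - ‖p‖) * ((1 - ‖p‖) / 2) := by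
          have := h.nonneg
          gcongr
      _ = ε := by field_simp
      _ ≤ 1 := hε
  have h3 : exp (Ψ ζ) - exp (Ψ p) = exp (Ψ p) * (exp (Ψ ζ - Ψ p) - 1) := by
    rw [exp_sub]
    field_simp [exp_ne_zero]
  have h4 := (norm_exp_sub_one_le h2).trans (mul_le_mul_of_nonneg_left h1 zero_le_two)
  rw [h3, norm_mul]
  calc (1 - ‖p‖) * (‖exp (Ψ p)‖ * ‖exp (Ψ ζ - Ψ p) - 1‖)
      ≤ (1 - ‖p‖) * (‖exp (Ψ p)‖ * (2 * (2 * ε / (1 - ‖p‖) * ‖ζ - p‖))) := by gcongr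
    _ = 4 * ε * ‖ζ - p‖ * ‖exp (Ψ p)‖ := by field_simp; ring

end IsPreSchwarzianSolution

/-! ### The reflected extension is a homeomorphism of the plane. -/

/-- The Ahlfors-Weill type extension of `f`, where `exp Ψ = f'`: outside of the closed disc it is
`f ζ + (z - ζ) f' ζ` where `ζ` is the reflection of `z` in the circle, and on the circle it is a
radial limit, taken along an ultrafilter in order not to have to discuss its existence first. -/
noncomputable def reflectExtend (Ψ f : ℂ → ℂ) (z : ℂ) : ℂ :=
  if ‖z‖ < 1 then f z
  else if ‖z‖ = 1 then
    Filter.limUnder ((Ultrafilter.of (𝓝[<] (1 : ℝ)) : Ultrafilter ℝ) : Filter ℝ)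
      fun r : ℝ => f (r * z)
  else f (conj z)⁻¹ + (z - (conj z)⁻¹) * exp (Ψ (conj z)⁻¹)

theorem reflectExtend_of_lt {Ψ f : ℂ → ℂ} {z : ℂ} (hz : ‖z‖ < 1) :
    reflectExtend Ψ f z = f z := by
  simp [reflectExtend, hz]

theorem reflectExtend_of_gt {Ψ f : ℂ → ℂ} {z : ℂ} (hz : 1 < ‖z‖) :
    reflectExtend Ψ f z = f (conj z)⁻¹ + (z - (conj z)⁻¹) * exp (Ψ (conj z)⁻¹) := by
  simp [reflectExtend, hz.le.not_gt, hz.ne']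

theorem norm_inv_conj (z : ℂ) : ‖(conj z)⁻¹‖ = ‖z‖⁻¹ := by simp

theorem norm_sub_inv_conj {z : ℂ} (hz : 1 < ‖z‖) : ‖z - (conj z)⁻¹‖ = ‖z‖ - ‖z‖⁻¹ := by
  have h0 : ‖z‖ ≠ 0 := by linarith
  have h1 : (conj z)⁻¹ = ((‖z‖ ^ 2)⁻¹ : ℝ) * z := by
    rw [Complex.inv_def, Complex.conj_conj, Complex.normSq_conj, Complex.normSq_eq_norm_sq,
      mul_comm]
  have h2 : z - (conj z)⁻¹ = ((1 - (‖z‖ ^ 2)⁻¹ : ℝ) : ℂ) * z := by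
    rw [h1]; push_cast; ring
  have h3 : (‖z‖ ^ 2)⁻¹ ≤ 1 := inv_le_one_of_one_le₀ (by nlinarith)
  rw [h2, norm_mul, norm_real, Real.norm_of_nonneg (by linarith)]
  field_simp

theorem norm_inv_conj_sub_inv_conj {z w : ℂ} (hz : z ≠ 0) (hw : w ≠ 0) :
    ‖(conj z)⁻¹ - (conj w)⁻¹‖ = ‖z - w‖ / (‖z‖ * ‖w‖) := by
  have h1 : (conj z)⁻¹ - (conj w)⁻¹ = conj ((w - z) / (z * w)) := by
    have hz' : conj z ≠ 0 := by simpa using hz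
    have hw' : conj w ≠ 0 := by simpa using hw
    simp only [map_div₀, map_sub, map_mul]
    field_simp
  rw [h1, norm_conj, norm_div, norm_mul, norm_sub_rev]

namespace IsPreSchwarzianSolution

variable {ε : ℝ} {ψ Ψ f : ℂ → ℂ}

theorem norm_sub_self_le (h : IsPreSchwarzianSolution ε ψ Ψ f) (hε : ε ≤ 1 / 2) {z : ℂ}
    (hz : ‖z‖ < 1) : ‖f z - z‖ ≤ 2 * ε := by
  simpa [h.map_zero, h.log_zero] using h.norm_sub_linear_le (p := 0) (z := z) (s := 1) (K := 1)
    one_pos (by simp) hz (by simpa using hz.le) (by simpa using hε)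

/-- The values `f (r z)` stay in a compact disc, where an ultrafilter always converges. -/
theorem tendsto_reflectExtend (h : IsPreSchwarzianSolution ε ψ Ψ f) (hε : ε ≤ 1 / 2) {z : ℂ}
    (hz : ‖z‖ = 1) :
    Filter.Tendsto (fun r : ℝ => f (r * z))
      ((Ultrafilter.of (𝓝[<] (1 : ℝ)) : Ultrafilter ℝ) : Filter ℝ)
      (𝓝 (reflectExtend Ψ f z)) := by
  have h1 : reflectExtend Ψ f z = Filter.limUnder
      ((Ultrafilter.of (𝓝[<] (1 : ℝ)) : Ultrafilter ℝ) : Filter ℝ) fun r : ℝ => f (r * z) := by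
    simp [reflectExtend, hz]
  rw [h1]
  apply tendsto_nhds_limUnder
  have hle : ((Ultrafilter.of (𝓝[<] (1 : ℝ)) : Ultrafilter ℝ) : Filter ℝ) ≤ 𝓝[<] (1 : ℝ) :=
    Ultrafilter.of_le _
  obtain ⟨y, -, hy⟩ := (isCompact_closedBall (0 : ℂ) 2).ultrafilter_le_nhds
    ((Ultrafilter.of (𝓝[<] (1 : ℝ))).map fun r : ℝ => f (r * z)) (by
      rw [Filter.le_principal_iff, Ultrafilter.coe_map, Filter.mem_map]
      apply hle
      filter_upwards [Ioo_mem_nhdsLT (show (0 : ℝ) < 1 by norm_num)] with r hr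
      have hn : ‖(r : ℂ) * z‖ = r := by
        rw [norm_mul, hz, mul_one, norm_real, Real.norm_of_nonneg hr.1.le]
      have h2 := h.norm_sub_self_le hε (z := r * z) (by rw [hn]; exact hr.2)
      have h3 := norm_le_norm_add_norm_sub' (f (r * z)) (r * z)
      rw [Set.mem_preimage, mem_closedBall_zero_iff]
      linarith [hr.2])
  exact ⟨y, hy⟩

/-- On the circle the interior estimate passes to the limit, with `K + 1` for `K`. Outside, the
error is that of `f` at `ζ` plus `(z - ζ)(f' ζ - f' p)`; the first factor is comparable to the depth
of `ζ`, which is what the Cauchy bound on `f' ζ - f' p` needs. Reflection costs a factor `3` in `K`,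
and `18 K² + 32 (6 K + 1)² ≤ 1600 K²`. -/
theorem norm_reflectExtend_sub_linear_le (h : IsPreSchwarzianSolution ε ψ Ψ f) {p z : ℂ} {K : ℝ}
    (hp : ‖p‖ < 1) (hz : ‖z‖ ≤ 4) (hK1 : 1 ≤ K) (hK : ‖z - p‖ ≤ K * (1 - ‖p‖))
    (ha : (6 * K + 1) * ε ≤ 1 / 2) :
    ‖reflectExtend Ψ f z - f p - (z - p) * exp (Ψ p)‖
      ≤ 1600 * K ^ 2 * ε * (1 - ‖p‖) * ‖exp (Ψ p)‖ := by
  have hε := h.nonneg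
  have hs0 : 0 < 1 - ‖p‖ := by linarith
  have hKε : 0 ≤ K * ε := mul_nonneg (by linarith) hε
  have hG : 0 ≤ (1 - ‖p‖) * ‖exp (Ψ p)‖ := by positivity
  have hεK : ε ≤ K * ε := le_mul_of_one_le_left hε hK1
  rcases lt_trichotomy ‖z‖ 1 with h1 | h1 | h1
  · rw [reflectExtend_of_lt h1]
    refine (h.norm_sub_linear_le hs0 le_rfl h1 hK (by nlinarith)).trans ?_
    have : 2 * K ^ 2 * ε ≤ 1600 * K ^ 2 * ε := by gcongr; norm_num
    nlinarith
  · have ht := h.tendsto_reflectExtend (by nlinarith) h1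
    have hle : ((Ultrafilter.of (𝓝[<] (1 : ℝ)) : Ultrafilter ℝ) : Filter ℝ) ≤ 𝓝[<] (1 : ℝ) :=
      Ultrafilter.of_le _
    have hid : Filter.Tendsto (fun r : ℝ => (r : ℂ) * z)
        ((Ultrafilter.of (𝓝[<] (1 : ℝ)) : Ultrafilter ℝ) : Filter ℝ) (𝓝 z) := by
      have : Filter.Tendsto (fun r : ℝ => (r : ℂ) * z) (𝓝 1) (𝓝 (((1 : ℝ) : ℂ) * z)) :=
        (by fun_prop : Continuous fun r : ℝ => (r : ℂ) * z).tendsto 1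
      simp only [ofReal_one, one_mul] at this
      exact this.mono_left (hle.trans nhdsWithin_le_nhds)
    refine le_of_tendsto (((ht.sub_const (f p)).sub ((hid.sub_const p).mul_const
      (exp (Ψ p)))).norm) (hle ?_)
    filter_upwards [Ioo_mem_nhdsLT (show (0 : ℝ) < 1 by norm_num),
      Ioo_mem_nhdsLT (show ‖p‖ < 1 from hp)] with r hr hr'
    have hn : ‖(r : ℂ) * z‖ = r := by
      rw [norm_mul, h1, mul_one, norm_real, Real.norm_of_nonneg hr.1.le]
    have hrz : ‖(r : ℂ) * z - z‖ ≤ 1 - ‖p‖ := by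
      have : (r : ℂ) * z - z = -(((1 - r : ℝ) : ℂ) * z) := by push_cast; ring
      rw [this, norm_neg, norm_mul, h1, mul_one, norm_real,
        Real.norm_of_nonneg (by linarith [hr.2])]
      linarith [hr'.1]
    have htri := norm_sub_le_norm_sub_add_norm_sub ((r : ℂ) * z) z p
    refine (h.norm_sub_linear_le (K := K + 1) hs0 le_rfl (by rw [hn]; exact hr.2)
      (by linarith) (by nlinarith)).trans ?_
    have : 2 * (K + 1) ^ 2 * ε ≤ 1600 * K ^ 2 * ε :=
      mul_le_mul_of_nonneg_right (by nlinarith) hε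
    nlinarith
  · set ζ := (conj z)⁻¹ with hζ
    have hζn : ‖ζ‖ = ‖z‖⁻¹ := norm_inv_conj z
    have hζ1 : ‖ζ‖ < 1 := by rw [hζn]; exact inv_lt_one_of_one_lt₀ h1
    have hzζ := norm_sub_inv_conj h1
    rw [← hζ] at hzζ
    have h0 : 0 < ‖z‖ := by linarith
    -- The exact ratio is `‖z‖ + 1`, whence the restriction to `‖z‖ ≤ 4`.
    have hzζ1 : ‖z - ζ‖ ≤ 8 * (1 - ‖ζ‖) := by
      rw [hzζ, hζn]
      field_simp
      nlinarith
    have hzζ2 : ‖z - ζ‖ ≤ 2 * ‖z - p‖ := by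
      have h2 : ‖z - ζ‖ ≤ 2 * (‖z‖ - 1) := by
        rw [hzζ]
        have : ‖z‖ * ‖z‖⁻¹ = 1 := mul_inv_cancel₀ h0.ne'
        nlinarith [sq_nonneg (‖z‖ - 1)]
      have h3 := norm_sub_norm_le z p
      linarith
    have hζp : ‖ζ - p‖ ≤ 3 * K * (1 - ‖p‖) := by
      have := norm_sub_le_norm_sub_add_norm_sub ζ z p
      rw [norm_sub_rev ζ z] at this
      linarith
    have e1 := h.norm_sub_linear_le (K := 3 * K) hs0 le_rfl hζ1 hζp (by nlinarith)
    have e2 := h.depth_mul_norm_deriv_sub_le (K := 3 * K) hp hζ1 hζp (by linarith)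
    have e3 : ‖(z - ζ) * (exp (Ψ ζ) - exp (Ψ p))‖
        ≤ 8 * (4 * (2 * (3 * K) + 1) ^ 2 * ε * (1 - ‖p‖) * ‖exp (Ψ p)‖) := by
      rw [norm_mul]
      have := mul_le_mul_of_nonneg_right hzζ1 (norm_nonneg (exp (Ψ ζ) - exp (Ψ p)))
      linarith
    have heq : reflectExtend Ψ f z - f p - (z - p) * exp (Ψ p)
        = (f ζ - f p - (ζ - p) * exp (Ψ p)) + (z - ζ) * (exp (Ψ ζ) - exp (Ψ p)) := by
      rw [reflectExtend_of_gt h1, ← hζ]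
      ring
    rw [heq]
    refine (norm_add_le _ _).trans ((add_le_add e1 e3).trans ?_)
    have : 2 * (3 * K) ^ 2 * ε + 8 * (4 * (2 * (3 * K) + 1) ^ 2 * ε) ≤ 1600 * K ^ 2 * ε := by
      rw [← mul_assoc, ← mul_assoc, ← add_mul]
      gcongr
      nlinarith
    nlinarith

/-- Near the disc this is the linear approximation at `p = 0` with `K = 4`, and `1600 · 4² = 25600`.
Far away `ζ` is close to `0`, so `f' ζ` is close to `1`. -/
theorem norm_reflectExtend_sub_self_le (h : IsPreSchwarzianSolution ε ψ Ψ f)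
    (hε : ε ≤ 1 / 10 ^ 7) (z : ℂ) :
    ‖reflectExtend Ψ f z - z‖ ≤ 25600 * ε * (1 + ‖z‖) := by
  have hε0 := h.nonneg
  rcases le_or_gt ‖z‖ 4 with h4 | h4
  · have := h.norm_reflectExtend_sub_linear_le (p := 0) (K := 4) (by simp) h4 (by norm_num)
      (by simpa using h4) (by linarith)
    simp only [h.map_zero, h.log_zero, sub_zero, exp_zero, mul_one, norm_zero, norm_one] at this
    nlinarith [norm_nonneg z]
  · have h1 : 1 < ‖z‖ := by linarith
    set ζ := (conj z)⁻¹ with hζ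
    have hζn : ‖ζ‖ = ‖z‖⁻¹ := norm_inv_conj z
    have hζ4 : ‖ζ‖ ≤ 1 / 4 := by
      rw [hζn, inv_le_comm₀ (by linarith) (by norm_num)]
      linarith
    have hzζ : ‖z - ζ‖ ≤ ‖z‖ := by
      rw [norm_sub_inv_conj h1]
      linarith [inv_nonneg.2 (norm_nonneg z)]
    have e1 := h.norm_sub_self_le (by linarith) (z := ζ) (by linarith)
    have e2 := h.depth_mul_norm_deriv_sub_le (p := 0) (ζ := ζ) (K := 1) (by simp) (by linarith)
      (by simp; linarith) (by linarith)
    simp only [h.log_zero, exp_zero, norm_zero, sub_zero, mul_one, norm_one] at e2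
    have e3 : ‖exp (Ψ ζ) - 1‖ ≤ 48 * ε := by
      nlinarith [norm_nonneg (exp (Ψ ζ) - 1)]
    have heq : reflectExtend Ψ f z - z = (f ζ - ζ) + (z - ζ) * (exp (Ψ ζ) - 1) := by
      rw [reflectExtend_of_gt h1, ← hζ]
      ring
    rw [heq]
    refine (norm_add_le _ _).trans ?_
    rw [norm_mul]
    have e4 : ‖z - ζ‖ * ‖exp (Ψ ζ) - 1‖ ≤ ‖z‖ * (48 * ε) := by gcongr
    nlinarith [norm_nonneg z]

/-- At every point and at every scale the extension is close to a linear conformal map. -/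
theorem exists_linear_approx (h : IsPreSchwarzianSolution ε ψ Ψ f) (hε : ε ≤ 1 / 10 ^ 7)
    (z₀ : ℂ) : ∃ M : ℝ, ∀ t : ℝ, 0 < t → ∃ A : ℂ, A ≠ 0 ∧ ‖A‖ ≤ M + t ^ (-(1 / 2) : ℝ) ∧
      ∀ z, ‖z - z₀‖ = t →
        ‖reflectExtend Ψ f z - reflectExtend Ψ f z₀ - A * (z - z₀)‖ ≤ ‖A‖ * t / 4 := by
  have hε0 := h.nonneg
  refine ⟨‖exp (Ψ z₀)‖ + ‖exp (Ψ (conj z₀)⁻¹)‖ + 1, fun t ht => ?_⟩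
  have htp : 0 ≤ t ^ (-(1 / 2) : ℝ) := Real.rpow_nonneg ht.le _
  have hpos1 := norm_nonneg (exp (Ψ z₀))
  have hpos2 := norm_nonneg (exp (Ψ (conj z₀)⁻¹))
  have key : ∀ p : ℂ, (∀ z, ‖z - z₀‖ ≤ t → ‖reflectExtend Ψ f z - f p - (z - p) * exp (Ψ p)‖
      ≤ ‖exp (Ψ p)‖ * t / 8) → ∀ z, ‖z - z₀‖ = t →
      ‖reflectExtend Ψ f z - reflectExtend Ψ f z₀ - exp (Ψ p) * (z - z₀)‖
        ≤ ‖exp (Ψ p)‖ * t / 4 := by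
    intro p hp z hz
    have e1 := hp z hz.le
    have e2 := hp z₀ (by simpa using ht.le)
    have heq : reflectExtend Ψ f z - reflectExtend Ψ f z₀ - exp (Ψ p) * (z - z₀)
      = (reflectExtend Ψ f z - f p - (z - p) * exp (Ψ p))
        - (reflectExtend Ψ f z₀ - f p - (z₀ - p) * exp (Ψ p)) := by ring
    rw [heq]
    have := norm_sub_le (reflectExtend Ψ f z - f p - (z - p) * exp (Ψ p))
      (reflectExtend Ψ f z₀ - f p - (z₀ - p) * exp (Ψ p))
    linarith
  -- Four regimes: the scale is small against the distance to the circle, from inside or from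
  -- outside; it is comparable to or exceeds that distance but is below `1/10`; or it is large. `A`
  -- is `f'` at `z₀`, at its reflection, at a point of depth `t` on the same ray, and at `0`.
  rcases le_or_gt (2 * t) (1 - ‖z₀‖) with hin | hin
  · refine ⟨exp (Ψ z₀), exp_ne_zero _, by linarith, fun z hz => ?_⟩
    have h1 : ‖z₀‖ < 1 := by linarith
    have h2 : ‖z‖ < 1 := by
      have := norm_le_norm_add_norm_sub' z z₀
      linarith
    rw [reflectExtend_of_lt h1, reflectExtend_of_lt h2, mul_comm]
    refine (h.norm_sub_linear_le ht (by linarith) h2 (K := 1) (by linarith) (by linarith)).trans ?_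
    have : 0 ≤ t * ‖exp (Ψ z₀)‖ := by positivity
    nlinarith
  rcases le_or_gt (2 * t) (‖z₀‖ - 1) with hout | hout
  · refine ⟨exp (Ψ (conj z₀)⁻¹), exp_ne_zero _, by linarith, fun z hz => ?_⟩
    have h1 : 1 < ‖z₀‖ := by linarith
    have htri := norm_sub_norm_le z z₀
    have htri' := norm_sub_norm_le z₀ z
    rw [norm_sub_rev z₀ z] at htri'
    rw [hz] at htri htri'
    have h2 : 1 < ‖z‖ := by linarith
    have hd := norm_inv_conj_sub_inv_conj (z := z) (w := z₀) (norm_pos_iff.1 (by linarith))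
      (norm_pos_iff.1 (by linarith))
    have hv := norm_sub_inv_conj h2
    have hn := norm_inv_conj z₀
    have hn' := norm_inv_conj z
    rw [reflectExtend_of_gt h1, reflectExtend_of_gt h2]
    set ζ := (conj z)⁻¹
    set ζ₀ := (conj z₀)⁻¹
    set a := ‖z‖
    set b := ‖z₀‖
    rw [hz] at hd
    have ha0 : 0 < a := by linarith
    have hb0 : 0 < b := by linarith
    have hd0 : 0 < ‖ζ - ζ₀‖ := by rw [hd]; positivity
    have hdt : ‖ζ - ζ₀‖ ≤ t := by
      rw [hd]
      exact div_le_self ht.le (one_le_mul_of_one_le_of_one_le h2.le h1.le)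
    have hds : ‖ζ - ζ₀‖ ≤ (1 - ‖ζ₀‖) / 2 := by
      rw [hd, hn]
      field_simp
      nlinarith
    have hζ₀ : ‖ζ₀‖ < 1 := by linarith
    have hζ : ‖ζ‖ < 1 := by rw [hn']; exact inv_lt_one_of_one_lt₀ h2
    have e1 := h.norm_sub_linear_le (p := ζ₀) hd0 (by linarith) hζ (K := 1) (by linarith)
      (by linarith)
    -- The Lipschitz form is essential: `t` may be far smaller than the depth of `ζ₀`, and the error
    -- must be proportional to `t`.
    have e2 := h.norm_deriv_sub_le_of_norm_sub_le hζ₀ hds (by linarith)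
    have hvd : ‖z - ζ‖ * ‖ζ - ζ₀‖ ≤ 3 * t * (1 - ‖ζ₀‖) := by
      have h3 : a ^ 2 - 1 ≤ 3 * (b - 1) * a ^ 2 := by
        have h4 : (a - 1) * (a + 1) ≤ (a - 1) * (2 * a ^ 2) :=
          mul_le_mul_of_nonneg_left (by nlinarith) (by linarith)
        have h5 : (a - 1) * (2 * a ^ 2) ≤ (3 / 2 * (b - 1)) * (2 * a ^ 2) :=
          mul_le_mul_of_nonneg_right (by linarith) (by positivity)
        linarith
      rw [hd, hv, hn]
      calc (a - a⁻¹) * (t / (a * b)) = t * ((a ^ 2 - 1) / (a ^ 2 * b)) := by field_simp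
        _ ≤ t * (3 * (b - 1) * a ^ 2 / (a ^ 2 * b)) := by gcongr
        _ = 3 * t * (1 - b⁻¹) := by field_simp
    set G := ‖exp (Ψ ζ₀)‖
    have hG : 0 ≤ G := norm_nonneg _
    set D := ‖exp (Ψ ζ) - exp (Ψ ζ₀)‖
    have e3 : ‖z - ζ‖ * D ≤ 12 * ε * t * G := by
      refine le_of_mul_le_mul_left ?_ (show 0 < 1 - ‖ζ₀‖ by linarith)
      calc (1 - ‖ζ₀‖) * (‖z - ζ‖ * D) = ‖z - ζ‖ * ((1 - ‖ζ₀‖) * D) := by ring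
        _ ≤ ‖z - ζ‖ * (4 * ε * ‖ζ - ζ₀‖ * G) := by gcongr
        _ = 4 * ε * G * (‖z - ζ‖ * ‖ζ - ζ₀‖) := by ring
        _ ≤ 4 * ε * G * (3 * t * (1 - ‖ζ₀‖)) := by gcongr
        _ = (1 - ‖ζ₀‖) * (12 * ε * t * G) := by ring
    have heq : f ζ + (z - ζ) * exp (Ψ ζ) - (f ζ₀ + (z₀ - ζ₀) * exp (Ψ ζ₀))
          - exp (Ψ ζ₀) * (z - z₀)
        = (f ζ - f ζ₀ - (ζ - ζ₀) * exp (Ψ ζ₀)) + (z - ζ) * (exp (Ψ ζ) - exp (Ψ ζ₀)) := by ring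
    rw [heq]
    refine (norm_add_le _ _).trans ?_
    rw [norm_mul]
    have e4 : 2 * 1 ^ 2 * ε * ‖ζ - ζ₀‖ * G ≤ 2 * 1 ^ 2 * ε * t * G := by gcongr
    have : 0 ≤ t * G := by positivity
    nlinarith
  rcases lt_or_ge t (1 / 10) with ht1 | ht1
  · have hb0 : 0 < ‖z₀‖ := by linarith
    have hbc : (‖z₀‖ : ℂ) ≠ 0 := ofReal_ne_zero.2 hb0.ne'
    set p : ℂ := ((1 - t : ℝ) : ℂ) * (z₀ / ‖z₀‖) with hp
    have hunit : ‖z₀ / (‖z₀‖ : ℂ)‖ = 1 := by simp [hb0.ne']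
    have hpn : ‖p‖ = 1 - t := by
      rw [hp, norm_mul, hunit, mul_one, norm_real, Real.norm_of_nonneg (by linarith)]
    have hzp : ‖z₀ - p‖ ≤ 3 * t := by
      have : z₀ - p = ((‖z₀‖ - (1 - t) : ℝ) : ℂ) * (z₀ / ‖z₀‖) := by
        rw [hp]
        push_cast
        field_simp
      rw [this, norm_mul, hunit, mul_one, norm_real, Real.norm_eq_abs, abs_le]
      constructor <;> linarith
    refine ⟨exp (Ψ p), exp_ne_zero _, ?_, key p fun z hz => ?_⟩
    · have h1 := h.norm_deriv_le_rpow (z := p) (by linarith)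
      rw [hpn, sub_sub_cancel] at h1
      have h2 : t ^ (-ε) ≤ t ^ (-(1 / 2) : ℝ) :=
        Real.rpow_le_rpow_of_exponent_ge ht (by linarith) (by linarith)
      linarith
    · have h1 := norm_sub_le_norm_sub_add_norm_sub z z₀ p
      have h2 := norm_le_norm_add_norm_sub' z z₀
      refine (h.norm_reflectExtend_sub_linear_le (p := p) (K := 4) (by linarith) (by linarith)
        (by norm_num) (by rw [hpn]; linarith) (by linarith)).trans ?_
      rw [hpn, sub_sub_cancel]
      have : 0 ≤ t * ‖exp (Ψ p)‖ := by positivity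
      nlinarith
  · refine ⟨exp (Ψ 0), exp_ne_zero _, ?_, key 0 fun z hz => ?_⟩
    · rw [h.log_zero, exp_zero, norm_one]
      linarith
    · simp only [h.map_zero, h.log_zero, sub_zero, exp_zero, mul_one, norm_one, one_mul]
      refine (h.norm_reflectExtend_sub_self_le hε z).trans ?_
      have h2 := norm_le_norm_add_norm_sub' z z₀
      have h3 : 1 + ‖z‖ ≤ 23 * t := by linarith
      calc 25600 * ε * (1 + ‖z‖) ≤ 25600 * ε * (23 * t) := by gcongr
        -- `25600 · 23 · ε ≤ 1/8` is where a bound of the order of `10⁻⁷` on `ε` is needed.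
        _ ≤ t / 8 := by nlinarith

theorem isHomeomorph_reflectExtend (h : IsPreSchwarzianSolution ε ψ Ψ f) (hε : ε ≤ 1 / 10 ^ 7) :
    IsHomeomorph (reflectExtend Ψ f) := by
  set F := reflectExtend Ψ f
  have hinj : Function.Injective F := by
    intro z w hzw
    by_contra hne
    obtain ⟨M, hM⟩ := h.exists_linear_approx hε w
    have ht : 0 < ‖z - w‖ := norm_pos_iff.2 (sub_ne_zero.2 hne)
    obtain ⟨A, hA, -, hAz⟩ := hM _ ht
    have := hAz z rfl
    change ‖F z - F w - _‖ ≤ _ at this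
    rw [hzw, sub_self, zero_sub, norm_neg, norm_mul] at this
    have hpos := mul_pos (norm_pos_iff.2 hA) ht
    linarith
  -- The bound on `‖A‖` may blow up as `t → 0`, but `‖A‖ t` tends to `0`, which is all that
  -- continuity needs.
  have hlim : ∀ M : ℝ,
      Filter.Tendsto (fun t : ℝ => (M + t ^ (-(1 / 2) : ℝ)) * t) (𝓝[>] 0) (𝓝 0) := by
    intro M
    have h1 : Filter.Tendsto (fun t : ℝ => M * t + t ^ (1 / 2 : ℝ)) (𝓝[>] 0) (𝓝 0) := by
      have hc : Continuous fun t : ℝ => M * t + t ^ (1 / 2 : ℝ) :=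
        (continuous_const.mul continuous_id).add (Real.continuous_rpow_const (by norm_num))
      have := hc.tendsto 0
      rw [Real.zero_rpow (by norm_num)] at this
      simp only [mul_zero, add_zero] at this
      exact this.mono_left nhdsWithin_le_nhds
    refine h1.congr' ?_
    filter_upwards [self_mem_nhdsWithin] with t ht
    rw [Set.mem_Ioi] at ht
    rw [add_mul]
    congr 1
    conv_rhs => rw [← Real.rpow_one t, ← Real.rpow_mul ht.le, ← Real.rpow_add ht]
    norm_num
  have hcont : Continuous F := by
    rw [continuous_iff_continuousAt]
    intro w
    obtain ⟨M, hM⟩ := h.exists_linear_approx hε w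
    rw [Metric.continuousAt_iff]
    intro δ hδ
    have h1 := (hlim M).eventually (gt_mem_nhds (show (0 : ℝ) < δ / 2 by linarith))
    rw [eventually_nhdsWithin_iff, Metric.eventually_nhds_iff] at h1
    obtain ⟨η, hη, hb⟩ := h1
    refine ⟨η, hη, fun z hz => ?_⟩
    rcases eq_or_ne z w with rfl | hne
    · simpa using hδ
    have ht : 0 < ‖z - w‖ := norm_pos_iff.2 (sub_ne_zero.2 hne)
    obtain ⟨A, hA, hAM, hAz⟩ := hM _ ht
    have h2 := hAz z rfl
    change ‖F z - F w - _‖ ≤ _ at h2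
    have h3 := hb (y := ‖z - w‖) (by
      rw [dist_zero_right, norm_norm, ← dist_eq_norm]; exact hz) ht
    have h4 : ‖A‖ * ‖z - w‖ ≤ _ := mul_le_mul_of_nonneg_right hAM ht.le
    have h5 := norm_le_norm_add_norm_sub' (F z - F w) (A * (z - w))
    rw [norm_mul] at h5
    rw [dist_eq_norm]
    linarith
  have hprop : IsProperMap F := by
    rw [isProperMap_iff_tendsto_cocompact]
    refine ⟨hcont, ?_⟩
    rw [← Metric.cobounded_eq_cocompact, ← tendsto_norm_atTop_iff_cobounded]
    have h1 : Filter.Tendsto (fun z : ℂ => ‖z‖ / 2 - 1) (Bornology.cobounded ℂ) Filter.atTop :=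
      Filter.tendsto_atTop_add_const_right _ _
        (tendsto_norm_cobounded_atTop.atTop_div_const (by norm_num))
    refine Filter.tendsto_atTop_mono (fun z => ?_) h1
    have h2 : ‖F z - z‖ ≤ _ := h.norm_reflectExtend_sub_self_le hε z
    have h3 := norm_le_norm_add_norm_sub (F z) z
    have h4 : 25600 * ε * (1 + ‖z‖) ≤ (1 / 2) * (1 + ‖z‖) := by
      gcongr
      linarith
    linarith
  -- Suppose `w` is omitted and `F z` is a nearest point of the closed range. A step `v` with `A v`
  -- pointing from `F z` to `w` gains `‖A‖ t` and loses at most `‖A‖ t / 4`, so `F (z + v)` is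
  -- nearer.
  have hsurj : Function.Surjective F := by
    intro w
    by_contra hw
    have hw' : w ∉ Set.range F := hw
    have hcl : IsClosed (Set.range F) := hprop.isClosedMap.isClosed_range
    obtain ⟨_, ⟨z, rfl⟩, hz⟩ := hcl.exists_infDist_eq_dist (Set.range_nonempty F) w
    set e := w - F z with he
    have he0 : 0 < ‖e‖ := by
      rw [norm_pos_iff, he, sub_ne_zero]
      rintro rfl
      exact hw' ⟨z, rfl⟩
    obtain ⟨M, hM⟩ := h.exists_linear_approx hε z
    have h1 := (hlim M).eventually (gt_mem_nhds he0)
    obtain ⟨t, hte, ht⟩ := (h1.and self_mem_nhdsWithin).exists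
    obtain ⟨A, hA, hAM, hAz⟩ := hM t ht
    have hAt : ‖A‖ * t < ‖e‖ := (mul_le_mul_of_nonneg_right hAM ht.le).trans_lt hte
    have hA0 := norm_pos_iff.2 hA
    have hec : (‖e‖ : ℂ) ≠ 0 := ofReal_ne_zero.2 he0.ne'
    set v : ℂ := ((‖A‖ * t / ‖e‖ : ℝ) : ℂ) * e / A with hv
    have hvt : ‖v‖ = t := by
      rw [hv, norm_div, norm_mul, norm_real, Real.norm_of_nonneg (by positivity)]
      field_simp
    have h2 := hAz (z + v) (by simpa using hvt)
    change ‖F (z + v) - F z - A * (z + v - z)‖ ≤ _ at h2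
    have h3 : e - A * (z + v - z) = ((1 - ‖A‖ * t / ‖e‖ : ℝ) : ℂ) * e := by
      rw [add_sub_cancel_left, hv]
      push_cast
      field_simp
    have h4 : ‖e - A * (z + v - z)‖ = ‖e‖ - ‖A‖ * t := by
      rw [h3, norm_mul, norm_real, Real.norm_of_nonneg]
      · field_simp
      · rw [sub_nonneg, div_le_one he0]
        exact hAt.le
    have h5 : dist w (F (z + v)) ≤ ‖e‖ - ‖A‖ * t + ‖A‖ * t / 4 := by
      rw [dist_eq_norm]
      have : w - F (z + v) = (e - A * (z + v - z)) - (F (z + v) - F z - A * (z + v - z)) := by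
        rw [he]; ring
      rw [this]
      exact (norm_sub_le _ _).trans (add_le_add h4.le h2)
    have h6 := Metric.infDist_le_dist_of_mem (x := w) (Set.mem_range_self (f := F) (z + v))
    rw [hz, dist_eq_norm] at h6
    have h7 : 0 < ‖A‖ * t := by positivity
    change ‖e‖ ≤ _ at h6
    linarith
  exact (isHomeomorph_iff_continuous_isClosedMap_bijective).2
    ⟨hcont, hprop.isClosedMap, hinj, hsurj⟩

end IsPreSchwarzianSolution

/-! ### Weak derivatives across the unit circle. -/

/-- By Fubini it suffices to integrate along horizontal lines. Each meets the circle in at most two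
points, and the fundamental theorem of calculus for a continuous function tolerates countably many
exceptions. -/
theorem integral_eq_zero_of_hasDerivAt_horizontal {H W : ℂ → ℂ} (hH : Continuous H)
    (hHs : HasCompactSupport H) (hW : Integrable W)
    (hd : ∀ z : ℂ, ‖z‖ ≠ 1 → HasDerivAt (fun t : ℝ => H (z + t)) (W z) 0) : ∫ z, W z = 0 := by
  have hmp := Complex.volume_preserving_equiv_real_prod.symm
  have hme := Complex.measurableEquivRealProd.symm.measurableEmbedding
  rw [← hmp.integral_comp hme]
  have hW' : Integrable (fun q : ℝ × ℝ => W (Complex.measurableEquivRealProd.symm q)) :=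
    (hmp.integrable_comp_emb hme).2 hW
  rw [Measure.volume_eq_prod] at hW' ⊢
  rw [integral_prod_symm _ hW']
  refine integral_eq_zero_of_ae ?_
  filter_upwards [hW'.prod_left_ae] with y hy
  obtain ⟨R, hR⟩ := hHs.isCompact.isBounded.subset_closedBall (0 : ℂ)
  set c : ℝ → ℂ := fun x => Complex.measurableEquivRealProd.symm (x, y)
  have hc : ∀ x : ℝ, c x = x + y * I := fun x => by
    apply Complex.ext <;> simp [c, Complex.measurableEquivRealProd_symm_apply]
  have hcc : Continuous c := by
    rw [show c = fun x : ℝ => (x : ℂ) + y * I from funext hc]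
    fun_prop
  have hcount : {x : ℝ | ‖c x‖ = 1}.Countable := by
    refine ((Set.finite_singleton (√(1 - y ^ 2))).insert (-√(1 - y ^ 2))).countable.mono ?_
    intro x hx
    have h1 : x ^ 2 + y ^ 2 = 1 := by
      have h2 : ‖c x‖ ^ 2 = 1 := by rw [show ‖c x‖ = 1 from hx]; norm_num
      rw [← Complex.normSq_eq_norm_sq, hc, Complex.normSq_add_mul_I] at h2
      exact h2
    have h3 : √(1 - y ^ 2) = |x| := by
      rw [← h1, add_sub_cancel_right, Real.sqrt_sq_eq_abs]
    rw [h3]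
    rcases abs_choice x with h | h <;> simp [h]
  have hlim := intervalIntegral_tendsto_integral hy
    (Filter.tendsto_neg_atTop_atBot.comp Filter.tendsto_id) (Filter.tendsto_id (α := ℝ))
  refine tendsto_nhds_unique hlim (tendsto_const_nhds.congr' ?_)
  filter_upwards [Filter.eventually_gt_atTop R, Filter.eventually_gt_atTop 0] with n hn hn0
  have hvan : ∀ x : ℝ, R < |x| → H (c x) = 0 := by
    intro x hx
    by_contra hne
    have h1 : c x ∈ closedBall (0 : ℂ) R := hR (subset_tsupport _ hne)
    rw [mem_closedBall_zero_iff] at h1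
    have h2 := (Complex.abs_re_le_norm (c x)).trans h1
    rw [hc] at h2
    simp at h2
    linarith
  have hint := integral_eq_of_hasDerivAt_off_countable
    (fun x => H (c x)) (fun x => W (c x)) (a := -n) (b := n) hcount
    (hH.comp hcc).continuousOn (fun x hx => ?_) (hy.intervalIntegrable)
  · simp only [Function.comp, id]
    rw [hint, hvan n (by rwa [abs_of_pos hn0]), hvan (-n) (by rwa [abs_neg, abs_of_pos hn0]),
      sub_self]
    rfl
  · have h1 := hd (c x) hx.2
    have h2 : HasDerivAt (fun t : ℝ => t - x) 1 x := (hasDerivAt_id x).sub_const x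
    have h4 := h1.scomp_of_eq x h2 (sub_self x).symm
    rw [one_smul] at h4
    refine h4.congr_of_eventuallyEq (Filter.Eventually.of_forall fun t => ?_)
    simp only [Function.comp, hc]
    congr 1
    push_cast
    ring

theorem integral_eq_zero_of_hasDerivAt_line {v : ℂ} (hv : ‖v‖ = 1) {H W : ℂ → ℂ}
    (hH : Continuous H) (hHs : HasCompactSupport H) (hW : Integrable W)
    (hd : ∀ z : ℂ, ‖z‖ ≠ 1 → HasDerivAt (fun t : ℝ => H (z + t * v)) (W z) 0) :
    ∫ z, W z = 0 := by
  set ρ : ℂ ≃ₗᵢ[ℝ] ℂ := rotation ⟨v, by simpa [Submonoid.unitSphere] using hv⟩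
  have hρ : ∀ z, ρ z = v * z := fun z => rfl
  have hmp : MeasurePreserving ρ := ρ.measurePreserving
  have hme : MeasurableEmbedding ρ := ρ.toHomeomorph.measurableEmbedding
  rw [← hmp.integral_comp hme]
  refine integral_eq_zero_of_hasDerivAt_horizontal (H := fun z => H (ρ z))
    (hH.comp ρ.continuous) (hHs.comp_homeomorph ρ.toHomeomorph)
    ((hmp.integrable_comp_emb hme).2 hW) fun z hz => ?_
  have := hd (ρ z) (by rwa [ρ.norm_map])
  refine this.congr_of_eventuallyEq (Filter.Eventually.of_forall fun t => ?_)
  simp only [hρ]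
  congr 1
  ring

/-- A continuous function that is differentiable off the unit circle, with locally square
integrable derivative, has that derivative as a weak derivative. -/
theorem hasWeakDirDeriv_of_differentiable_off_circle {F : ℂ → ℂ} (hF : Continuous F)
    (hd : ∀ z : ℂ, ‖z‖ ≠ 1 → DifferentiableAt ℝ F z) {v : ℂ} (hv : ‖v‖ = 1)
    (hL : TeichCurve.IsLocallyL2 fun z => fderiv ℝ F z v) :
    TeichCurve.HasWeakDirDeriv F (fun z => fderiv ℝ F z v) v := by
  intro φ hφ hφs
  have hloc : LocallyIntegrable (fun z => fderiv ℝ F z v) := by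
    intro x
    have : IsFiniteMeasure (volume.restrict (closedBall (0 : ℂ) (‖x‖ + 1))) :=
      isFiniteMeasure_restrict.2 measure_closedBall_lt_top.ne
    refine ⟨closedBall 0 (‖x‖ + 1), ?_, (hL (‖x‖ + 1)).integrable one_le_two⟩
    refine Filter.mem_of_superset (ball_mem_nhds x one_pos) fun z hz => ?_
    rw [mem_ball_iff_norm] at hz
    rw [mem_closedBall_zero_iff]
    have := norm_le_norm_add_norm_sub' z x
    linarith
  have h1 : Integrable fun z => φ z • fderiv ℝ F z v :=
    hloc.integrable_smul_left_of_hasCompactSupport hφ.continuous hφs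
  have hdφ : Continuous fun z => fderiv ℝ φ z v :=
    (hφ.continuous_fderiv (by simp)).clm_apply continuous_const
  have h2 : Integrable fun z => (fderiv ℝ φ z v) • F z := by
    refine (hdφ.smul hF).integrable_of_hasCompactSupport ?_
    exact (hφs.fderiv_apply (𝕜 := ℝ) v).smul_right
  rw [← sub_eq_zero, sub_neg_eq_add, ← integral_add h2 h1]
  refine integral_eq_zero_of_hasDerivAt_line hv (H := fun z => φ z • F z)
    (hφ.continuous.smul hF) hφs.smul_right (h2.add h1) fun z hz => ?_
  have h3 := ((hφ.differentiable (by simp)) z).hasFDerivAt.smul (hd z hz).hasFDerivAt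
  have h4 : HasDerivAt (fun t : ℝ => z + t * v) v 0 := by
    simpa using ((ofRealCLM.hasDerivAt (x := (0 : ℝ))).mul_const v).const_add z
  have h5 := HasFDerivAt.comp_hasDerivAt_of_eq (0 : ℝ) h3 h4 (by simp)
  refine h5.congr_deriv ?_
  simp [add_comm]

/-- In polar coordinates this is a one-dimensional singularity of exponent above `-1`. -/
theorem integrableOn_abs_norm_sub_one_rpow (R : ℝ) :
    IntegrableOn (fun z : ℂ => |‖z‖ - 1| ^ (-(1 / 2) : ℝ)) (closedBall 0 R) := by
  have hbase : ∀ b : ℝ, IntervalIntegrable (fun y : ℝ => y ^ (-(1 / 2) : ℝ)) volume 0 b :=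
    fun b => intervalIntegral.intervalIntegrable_rpow' (by norm_num)
  have h1 : IntegrableOn (fun y : ℝ => |y - 1| ^ (-(1 / 2) : ℝ)) (Set.Ioc 0 1) := by
    have h2 := ((hbase 1).comp_sub_left 1).symm
    norm_num at h2
    rw [intervalIntegrable_iff_integrableOn_Ioc_of_le zero_le_one] at h2
    refine h2.congr_fun (fun y hy => ?_) measurableSet_Ioc
    simp only
    rw [abs_of_nonpos (by linarith [hy.2]), neg_sub]
  have h2 : IntegrableOn (fun y : ℝ => |y - 1| ^ (-(1 / 2) : ℝ)) (Set.Ioc 1 (1 + |R| + 1)) := by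
    have h2 := (hbase (|R| + 1)).comp_sub_right 1
    norm_num at h2
    rw [intervalIntegrable_iff_integrableOn_Ioc_of_le (by linarith [abs_nonneg R])] at h2
    have h3 : |R| + 1 + 1 = 1 + |R| + 1 := by ring
    rw [h3] at h2
    refine h2.congr_fun (fun y hy => ?_) measurableSet_Ioc
    simp only
    rw [abs_of_nonneg (by linarith [hy.1])]
  have h3 := h1.union h2
  rw [Set.Ioc_union_Ioc_eq_Ioc zero_le_one (by linarith [abs_nonneg R])] at h3
  have h4 : IntegrableOn (fun z : ℂ => |‖z‖ - 1| ^ (-(1 / 2) : ℝ)) (ball 0 (1 + |R| + 1)) := by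
    refine (integrableOn_fun_norm_addHaar (f := fun y : ℝ => |y - 1| ^ (-(1 / 2) : ℝ)) volume).2 ?_
    refine IntegrableOn.mono_set (t := Set.Icc 0 (1 + |R| + 1)) ?_ Set.Ioo_subset_Icc_self
    exact ((integrableOn_Icc_iff_integrableOn_Ioc).2 h3).continuousOn_smul (by fun_prop)
      isCompact_Icc
  exact h4.mono_set (closedBall_subset_ball (by linarith [le_abs_self R]))

theorem hasFDerivAt_inv_conj {z : ℂ} (hz : z ≠ 0) :
    HasFDerivAt (fun z : ℂ => (conj z)⁻¹)
      (-((conj z)⁻¹) ^ 2 • (conjCLE : ℂ →L[ℝ] ℂ)) z := by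
  have h1 : HasFDerivAt (fun z : ℂ => conj z) (conjCLE : ℂ →L[ℝ] ℂ) z := conjCLE.hasFDerivAt
  have h2 := (hasDerivAt_inv (x := conj z) (by simpa using hz)).comp_hasFDerivAt z h1
  rw [inv_pow]
  exact h2

/-! ### The Beltrami inequality and square integrability. -/

namespace IsPreSchwarzianSolution

variable {ε : ℝ} {ψ Ψ f : ℂ → ℂ}

theorem hasFDerivAt_reflectExtend_of_lt (h : IsPreSchwarzianSolution ε ψ Ψ f) {z : ℂ}
    (hz : ‖z‖ < 1) : ∃ D : ℂ →L[ℝ] ℂ, HasFDerivAt (reflectExtend Ψ f) D z ∧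
      ∀ v, D v = exp (Ψ z) * v := by
  have hz' : z ∈ ball (0 : ℂ) 1 := by simpa using hz
  have h1 := ((h.hasDerivAt z hz').hasFDerivAt.restrictScalars ℝ)
  refine ⟨_, h1.congr_of_eventuallyEq ?_, fun v => by simp [mul_comm]⟩
  filter_upwards [isOpen_ball.mem_nhds hz'] with w hw
  exact reflectExtend_of_lt (by simpa using hw)

/-- The two terms `f' ζ dζ` cancel, leaving `f' ζ dz + (z - ζ) f'' ζ dζ` with `dζ = -ζ² conj dz`. -/
theorem hasFDerivAt_reflectExtend_of_gt (h : IsPreSchwarzianSolution ε ψ Ψ f) {z : ℂ}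
    (hz : 1 < ‖z‖) : ∃ D : ℂ →L[ℝ] ℂ, HasFDerivAt (reflectExtend Ψ f) D z ∧
      ∀ v, D v = exp (Ψ (conj z)⁻¹) * v +
        -((z - (conj z)⁻¹) * (conj z)⁻¹ ^ 2 * ψ (conj z)⁻¹ * exp (Ψ (conj z)⁻¹)) * conj v := by
  have hz0 : z ≠ 0 := norm_pos_iff.1 (by linarith)
  have hζ : (conj z)⁻¹ ∈ ball (0 : ℂ) 1 := by
    rw [mem_ball_zero_iff, norm_inv_conj]
    exact inv_lt_one_of_one_lt₀ hz
  have h1 := hasFDerivAt_inv_conj hz0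
  have h2 := (h.hasDerivAt _ hζ).comp_hasFDerivAt z h1
  have h3 := ((h.hasDerivAt_log _ hζ).cexp).comp_hasFDerivAt z h1
  have h4 := h2.add (((hasFDerivAt_id (𝕜 := ℝ) z).sub h1).mul h3)
  refine ⟨_, h4.congr_of_eventuallyEq ?_, fun v => ?_⟩
  · filter_upwards [(isOpen_lt continuous_const continuous_norm).mem_nhds hz] with w hw
    exact reflectExtend_of_gt hw
  · simp
    ring

theorem differentiableAt_reflectExtend (h : IsPreSchwarzianSolution ε ψ Ψ f) {z : ℂ}
    (hz : ‖z‖ ≠ 1) : DifferentiableAt ℝ (reflectExtend Ψ f) z := by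
  rcases lt_or_gt_of_ne hz with h1 | h1
  · obtain ⟨D, hD, -⟩ := h.hasFDerivAt_reflectExtend_of_lt h1
    exact hD.differentiableAt
  · obtain ⟨D, hD, -⟩ := h.hasFDerivAt_reflectExtend_of_gt h1
    exact hD.differentiableAt

/-- The Beltrami inequality, and the growth of the derivative at the circle. -/
theorem exists_fderiv_reflectExtend (h : IsPreSchwarzianSolution ε ψ Ψ f) (hε : ε ≤ 1 / 4) {z : ℂ}
    (hz : ‖z‖ ≠ 1) : ∃ P Q : ℂ, (∀ v, fderiv ℝ (reflectExtend Ψ f) z v = P * v + Q * conj v) ∧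
      ‖Q‖ ≤ 1 / 2 * ‖P‖ ∧ ‖P‖ ≤ (1 + ‖z‖) * (1 + |‖z‖ - 1| ^ (-(1 / 4) : ℝ)) := by
  have hε0 := h.nonneg
  -- The exponent `-1/4` squares to the integrable `-1/2`; the summand `1` covers `x ≥ 1`.
  have hpow : ∀ x : ℝ, 0 < x → x ^ (-ε) ≤ 1 + x ^ (-(1 / 4) : ℝ) := by
    intro x hx
    rcases le_total x 1 with h1 | h1
    · have := Real.rpow_le_rpow_of_exponent_ge hx h1 (show (-(1 / 4) : ℝ) ≤ -ε by linarith)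
      linarith
    · have h2 := Real.rpow_le_one_of_one_le_of_nonpos h1 (show -ε ≤ 0 by linarith)
      have h3 := Real.rpow_nonneg hx.le (-(1 / 4) : ℝ)
      linarith
  rcases lt_or_gt_of_ne hz with h1 | h1
  · obtain ⟨D, hD, hv⟩ := h.hasFDerivAt_reflectExtend_of_lt h1
    refine ⟨exp (Ψ z), 0, fun v => by rw [hD.fderiv, hv]; simp, by simp, ?_⟩
    have h2 := h.norm_deriv_le_rpow h1
    have h3 := hpow (1 - ‖z‖) (by linarith)
    rw [abs_sub_comm, abs_of_pos (by linarith)]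
    have h4 := Real.rpow_nonneg (show 0 ≤ 1 - ‖z‖ by linarith) (-(1 / 4) : ℝ)
    nlinarith [norm_nonneg z]
  · obtain ⟨D, hD, hv⟩ := h.hasFDerivAt_reflectExtend_of_gt h1
    refine ⟨_, _, fun v => by rw [hD.fderiv, hv], ?_, ?_⟩
    · have hζn := norm_inv_conj z
      have hζ : ‖(conj z)⁻¹‖ < 1 := by
        rw [hζn]
        exact inv_lt_one_of_one_lt₀ h1
      have hb := h.bound (conj z)⁻¹ (by simpa using hζ)
      have h0 : 0 < ‖z‖ := by linarith
      have hfac : ‖z - (conj z)⁻¹‖ * ‖(conj z)⁻¹‖ ^ 2 ≤ 2 * (1 - ‖(conj z)⁻¹‖) := by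
        rw [norm_sub_inv_conj h1, hζn]
        field_simp
        nlinarith [sq_nonneg (‖z‖ - 1)]
      rw [norm_neg, norm_mul, norm_mul, norm_mul, norm_pow]
      gcongr
      calc ‖z - (conj z)⁻¹‖ * ‖(conj z)⁻¹‖ ^ 2 * ‖ψ (conj z)⁻¹‖
          ≤ 2 * (1 - ‖(conj z)⁻¹‖) * ‖ψ (conj z)⁻¹‖ := by gcongr
        _ ≤ 1 / 2 := by linarith
    · have h2 := h.norm_deriv_le_rpow (z := (conj z)⁻¹) (by
        rw [norm_inv_conj]
        exact inv_lt_one_of_one_lt₀ h1)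
      have h0 : 0 < ‖z‖ := by linarith
      have h3 : 1 - ‖(conj z)⁻¹‖ = ‖z‖⁻¹ * (‖z‖ - 1) := by
        rw [norm_inv_conj]
        field_simp
      rw [h3, Real.mul_rpow (by positivity) (by linarith), Real.inv_rpow h0.le,
        Real.rpow_neg h0.le, inv_inv] at h2
      rw [abs_of_pos (by linarith)]
      refine h2.trans ?_
      have h4 : ‖z‖ ^ ε ≤ 1 + ‖z‖ := by
        have := Real.rpow_le_rpow_of_exponent_le h1.le (show ε ≤ 1 by linarith)
        rw [Real.rpow_one] at this
        linarith
      have h5 := Real.rpow_nonneg (show 0 ≤ ‖z‖ - 1 by linarith) (-ε)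
      exact mul_le_mul h4 (hpow _ (by linarith)) h5 (by linarith)

theorem ae_norm_ne_one : ∀ᵐ z : ℂ, ‖z‖ ≠ 1 := by
  have h : volume (sphere (0 : ℂ) 1) = 0 := Measure.addHaar_sphere _ _ _
  refine (measure_eq_zero_iff_ae_notMem.1 h).mono fun z hz => ?_
  simpa using hz

theorem isLocallyL2_fderiv_reflectExtend (h : IsPreSchwarzianSolution ε ψ Ψ f) (hε : ε ≤ 1 / 4)
    {v : ℂ} (hv : ‖v‖ = 1) :
    TeichCurve.IsLocallyL2 fun z => fderiv ℝ (reflectExtend Ψ f) z v := by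
  intro R
  have hm : AEStronglyMeasurable (fun z => fderiv ℝ (reflectExtend Ψ f) z v)
      (volume.restrict (closedBall (0 : ℂ) R)) :=
    (measurable_fderiv_apply_const ℝ (reflectExtend Ψ f) v).aestronglyMeasurable
  rw [memLp_two_iff_integrable_sq_norm hm]
  have : IsFiniteMeasure (volume.restrict (closedBall (0 : ℂ) R)) :=
    isFiniteMeasure_restrict.2 measure_closedBall_lt_top.ne
  have hdom : Integrable (fun z : ℂ => 8 * (1 + R) ^ 2 * (1 + |‖z‖ - 1| ^ (-(1 / 2) : ℝ)))
      (volume.restrict (closedBall (0 : ℂ) R)) :=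
    ((integrable_const 1).add (integrableOn_abs_norm_sub_one_rpow R)).const_mul _
  refine hdom.mono' (hm.norm.pow 2) ?_
  filter_upwards [ae_restrict_of_ae ae_norm_ne_one,
    ae_restrict_mem (measurableSet_closedBall)] with z hz hzR
  rw [mem_closedBall_zero_iff] at hzR
  obtain ⟨P, Q, hPQ, hQ, hP⟩ := h.exists_fderiv_reflectExtend hε hz
  have hx : 0 ≤ |‖z‖ - 1| := abs_nonneg _
  set y := |‖z‖ - 1| ^ (-(1 / 4) : ℝ) with hy
  have hy0 : 0 ≤ y := Real.rpow_nonneg hx _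
  have hyy : |‖z‖ - 1| ^ (-(1 / 2) : ℝ) = y ^ 2 := by
    rw [hy, ← Real.rpow_natCast, ← Real.rpow_mul hx]
    norm_num
  rw [hyy, Real.norm_of_nonneg (by positivity), hPQ]
  have h1 : ‖P * v + Q * conj v‖ ≤ 2 * ((1 + R) * (1 + y)) := by
    refine (norm_add_le _ _).trans ?_
    rw [norm_mul, norm_mul, norm_conj, hv, mul_one, mul_one]
    have : (1 + ‖z‖) * (1 + y) ≤ (1 + R) * (1 + y) := by gcongr
    linarith [norm_nonneg P]
  calc ‖P * v + Q * conj v‖ ^ 2 ≤ (2 * ((1 + R) * (1 + y))) ^ 2 := by gcongr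
    _ = 4 * (1 + R) ^ 2 * (1 + y) ^ 2 := by ring
    _ ≤ 4 * (1 + R) ^ 2 * (2 * (1 + y ^ 2)) := by
        gcongr
        nlinarith [sq_nonneg (1 - y)]
    _ = 8 * (1 + R) ^ 2 * (1 + y ^ 2) := by ring

theorem isQuasiconformal_reflectExtend (h : IsPreSchwarzianSolution ε ψ Ψ f)
    (hε : ε ≤ 1 / 10 ^ 7) : TeichCurve.IsQuasiconformal (reflectExtend Ψ f) := by
  have hε' : ε ≤ 1 / 4 := by linarith
  have hF := h.isHomeomorph_reflectExtend hε
  have h1 := h.isLocallyL2_fderiv_reflectExtend hε' (v := 1) (by simp)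
  have hI := h.isLocallyL2_fderiv_reflectExtend hε' (v := I) (by simp)
  have hd : ∀ z : ℂ, ‖z‖ ≠ 1 → DifferentiableAt ℝ (reflectExtend Ψ f) z :=
    fun z hz => h.differentiableAt_reflectExtend hz
  refine ⟨hF, _, _, h1, hI,
    hasWeakDirDeriv_of_differentiable_off_circle hF.continuous hd (by simp) h1,
    hasWeakDirDeriv_of_differentiable_off_circle hF.continuous hd (by simp) hI,
    1 / 2, by norm_num, by norm_num, ?_⟩
  filter_upwards [ae_norm_ne_one] with z hz
  obtain ⟨P, Q, hPQ, hQ, -⟩ := h.exists_fderiv_reflectExtend hε' hz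
  have e1 : (P * 1 + Q * conj 1 + I * (P * I + Q * conj I)) / 2 = Q := by
    simp only [map_one, conj_I]
    linear_combination (P - Q) / 2 * I_sq
  have e2 : (P * 1 + Q * conj 1 - I * (P * I + Q * conj I)) / 2 = P := by
    simp only [map_one, conj_I]
    linear_combination (Q - P) / 2 * I_sq
  rw [hPQ, hPQ, e1, e2]
  exact hQ

end IsPreSchwarzianSolution

/-! ### The two halves of the theorem. -/

namespace TeichCurve

theorem theta_mem_range_toFun {f : Disc → ℂ} (hf : f ∈ DTilde) :
    theta f ∈ Set.range BlochSpace.toFun := by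
  obtain ⟨hhol, hinj, -⟩ := hf
  have hinj' : Set.InjOn (extendZero f) Disc := by
    intro z hz w hw hzw
    have h1 := extendZero_apply f ⟨z, hz⟩
    have h2 := extendZero_apply f ⟨w, hw⟩
    simp only at h1 h2
    rw [h1, h2] at hzw
    exact congrArg Subtype.val (hinj hzw)
  have heq1 : Set.EqOn (extendZero (discDeriv f)) (deriv (extendZero f)) Disc := fun z hz =>
    extendZero_apply (discDeriv f) ⟨z, hz⟩
  have hder2 : ∀ z : Disc, discDeriv (discDeriv f) z = deriv (deriv (extendZero f)) z := fun z =>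
    (heq1.eventuallyEq_of_mem (isOpen_ball.mem_nhds z.2)).deriv_eq
  have htheta : ∀ z : Disc,
      theta f z = deriv (deriv (extendZero f)) z / deriv (extendZero f) z := fun z => by
    rw [theta, hder2]
    rfl
  have hne : ∀ z ∈ Disc, deriv (extendZero f) z ≠ 0 := fun z hz =>
    deriv_ne_zero_of_injOn isOpen_ball hhol hinj' hz
  have hd1 : DifferentiableOn ℂ (deriv (extendZero f)) Disc :=
    DifferentiableOn.deriv hhol isOpen_ball
  have hmem : theta f ∈ blochSubmodule := by
    -- Twice `200`, since `1 - |z|² ≤ 2 (1 - |z|)`.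
    refine ⟨?_, 400, ?_⟩
    · refine ((hd1.deriv isOpen_ball).div hd1 hne).congr fun z hz => ?_
      exact (extendZero_apply (theta f) ⟨z, hz⟩).trans (htheta ⟨z, hz⟩)
    · rintro _ ⟨z, rfl⟩
      have hz : ‖(z : ℂ)‖ < 1 := mem_ball_zero_iff.1 z.2
      have h1 := norm_deriv_deriv_mul_le_of_injOn hhol hinj' z.2
      have h2 : (1 - (‖(z : ℂ)‖ : ℂ) ^ 2) = (((1 - ‖(z : ℂ)‖) * (1 + ‖(z : ℂ)‖) : ℝ) : ℂ) := by
        push_cast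
        ring
      have h3 := norm_pos_iff.2 (hne z z.2)
      have h4 := norm_nonneg (z : ℂ)
      rw [weighted, htheta, h2, norm_mul, norm_div, norm_real,
        Real.norm_of_nonneg (by nlinarith), div_mul_eq_mul_div, div_le_iff₀ h3]
      nlinarith [norm_nonneg (deriv (extendZero f) z)]
  exact ⟨⟨theta f, hmem⟩, rfl⟩

theorem exists_mem_DTilde_theta_eq {ψ : BlochSpace} (hψ : ‖ψ‖ ≤ 1 / 10 ^ 7) :
    ∃ f ∈ DTilde, theta f = ψ.toFun := by
  have hhol : DifferentiableOn ℂ (extendZero ψ.toFun) Disc := ψ.2.1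
  obtain ⟨Ψ, hΨ0, hΨ⟩ := hhol.isExactOn_ball.with_val_at 0 0
  have hexp : DifferentiableOn ℂ (fun z => exp (Ψ z)) (ball 0 1) := fun z hz =>
    (hΨ z hz).cexp.differentiableAt.differentiableWithinAt
  obtain ⟨f, hf0, hf⟩ := hexp.isExactOn_ball.with_val_at 0 0
  have h : IsPreSchwarzianSolution (1 / 10 ^ 7) (extendZero ψ.toFun) Ψ f :=
    { nonneg := by norm_num
      hasDerivAt_log := hΨ
      hasDerivAt := hf
      bound := by
        intro z hz
        have h1 : ‖extendZero ψ.toFun z * (1 - (‖z‖ : ℂ) ^ 2)‖ ≤ 1 / 10 ^ 7 := by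
          have := (ψ.weighted_le_norm ⟨z, hz⟩).trans hψ
          rwa [weighted, ← extendZero_apply ψ.toFun] at this
        have hz1 : ‖z‖ < 1 := mem_ball_zero_iff.1 hz
        have h2 : (1 - (‖z‖ : ℂ) ^ 2) = (((1 - ‖z‖) * (1 + ‖z‖) : ℝ) : ℂ) := by
          push_cast
          ring
        have h3 := norm_nonneg z
        rw [h2, norm_mul, norm_real, Real.norm_of_nonneg (by nlinarith)] at h1
        refine le_trans ?_ h1
        gcongr
        nlinarith
      log_zero := hΨ0
      map_zero := hf0 }
  have hqc := h.isQuasiconformal_reflectExtend le_rfl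
  have heq0 : Set.EqOn (extendZero fun z : Disc => f z) f Disc := fun z hz =>
    extendZero_apply (fun z : Disc => f z) ⟨z, hz⟩
  have hder1 : ∀ z : Disc, discDeriv (fun z : Disc => f z) z = exp (Ψ z) := fun z =>
    ((heq0.eventuallyEq_of_mem (isOpen_ball.mem_nhds z.2)).deriv_eq).trans (hf z z.2).deriv
  have heq1 : Set.EqOn (extendZero (discDeriv fun z : Disc => f z)) (fun z => exp (Ψ z)) Disc :=
    fun z hz => (extendZero_apply _ ⟨z, hz⟩).trans (hder1 ⟨z, hz⟩)
  have hder2 : ∀ z : Disc, discDeriv (discDeriv fun z : Disc => f z) z = exp (Ψ z) * ψ.toFun z :=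
    fun z => ((heq1.eventuallyEq_of_mem (isOpen_ball.mem_nhds z.2)).deriv_eq).trans <| by
      rw [(hΨ z z.2).cexp.deriv, extendZero_apply]
  have hext : ∀ z : Disc, reflectExtend Ψ f z = f z := fun z =>
    reflectExtend_of_lt (mem_ball_zero_iff.1 z.2)
  refine ⟨fun z : Disc => f z, ⟨?_, ?_, hf0, ?_, reflectExtend Ψ f, hqc, hext⟩, ?_⟩
  · exact DifferentiableOn.congr
      (fun z hz => (hf z hz).differentiableAt.differentiableWithinAt) heq0
  -- Univalence of `f` is inherited from its extension, a homeomorphism.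
  · intro z w hzw
    refine Subtype.ext (hqc.1.injective ?_)
    rw [hext, hext]
    exact hzw
  · rw [hder1]
    simp [Disc.zero, hΨ0]
  · funext z
    rw [theta, hder1, hder2]
    exact mul_div_cancel_left₀ _ (exp_ne_zero _)

end TeichCurve

theorem theoremA3 :
    (∀ f ∈ TeichCurve.DTilde, TeichCurve.theta f ∈ Set.range TeichCurve.BlochSpace.toFun) ∧
    ∃ r : ℝ, 0 < r ∧
      ∀ ψ ∈ Metric.ball (0 : TeichCurve.BlochSpace) r,
        ∃ f ∈ TeichCurve.DTilde, TeichCurve.theta f = ψ.toFun :=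
  ⟨fun _ hf => TeichCurve.theta_mem_range_toFun hf, 1 / 10 ^ 7, by norm_num, fun _ hψ =>
    TeichCurve.exists_mem_DTilde_theta_eq (mem_ball_zero_iff.1 hψ).le⟩
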